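/- **Setting.** Let $d\in\{2,3\}$ and let $\mathcal T^H$ be a finite conforming grid of convex polytopes in $\mathbb R^d$ (the coarse cells $Q_1,\dots,Q_{N_c}$), let $\Omega$ be the interior of $\bigcup_i Q_i$, let $\mathcal B^\epsilon$ be a finite union of closed balls, and put $\Omega^\epsilon=\Omega\setminus\mathcal B^\epsilon$ and $K_i=\operatorname{int}(Q_i)\setminus\mathcal B^\epsilon$. Let $K_{i,m}$ be the region obtained by enlarging $K_i$ by $m$ layers of coarse cells: with $I_{i,0}=\{i\}$ and $I_{i,m+1}=\{j : Q_j\cap Q_{j'}\neq\emptyset \text{ for some } j'\in I_{i,m}\}$, $K_{i,m}=\operatorname{int}\big(\bigcup_{j\in I_{i,m}}Q_j\big)\setminus\mathcal B^\epsilon$. Let $\{\chi_j\}$ be a Lipschitz partition of unity on $\bigcup_iQ_i$ indexed by the vertices of the grid (for example the Lagrange basis): $0\le\chi_j\le1$, $\sum_j\chi_j=1$, $\chi_j=0$ on the cells that do not have $j$ as a vertex, and for every cell the bubble function $B=\prod_j\chi_j$ (product over the vertices of the cell) is positive in the interior and zero on the boundary of the cell. Put $\tilde\kappa=\sum_j|\nabla\chi_j|^2$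 and $$a(u,v)=\int_{\Omega^\epsilon}\nabla u\cdot\nabla v,\quad a_i(u,v)=\int_{K_i}\nabla u\cdot\nabla v,\quad s_i(u,v)=\int_{K_i}\tilde\kappa uv,\quad s=\sum_i s_i,\quad \|u\|_a^2=a(u,u),\quad \|u\|_{s(K_i)}^2=s_i(u,u).$$ Let $V$ be the space of $v\in H^1(\Omega^\epsilon)$ that vanish on $\partial\Omega^\epsilon\setminus\partial\mathcal B^\epsilon$, and $V_0(K_{i,m})$ the space of $v\in H^1(K_{i,m})$ that vanish on $\partial K_{i,m}\setminus\partial\mathcal B^\epsilon$, extended by zero. For each $i$ let $0=\lambda_1^i\le\lambda_2^i\le\cdots$ be the eigenvalues, counted with multiplicity (given by the min-max principle), of the problem $a_i(\phi,v)=\lambda s_i(\phi,v)$ for all $v\in H^1(K_i)$. Let $l_i\ge1$, let $\phi_1^i,\dots,\phi_{l_i}^i$ be $s_i$-orthonormal eigenfunctions for $\lambda_1^i,\dots,\lambda_{l_i}^i$, extended by zero, and let $V_{\rm aux}$ be the span of all the $\phi_j^i$. Assume $\lambda_{l_i+1}^i>0$ for all $i$. A function $\psi$ is called $\phi_j^i$-orthogonal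 if $s(\psi,\phi_j^i)=1$ and $s(\psi,\phi_{j'}^{i'})=0$ for all $(i',j')\ne(i,j)$. For a set $\omega\subset\Omega^\epsilon$ put $$\Lambda_\omega=\min_{K_i\cap\omega\ne\emptyset}\lambda_{l_i+1}^i,\qquad \Gamma_\omega=\max_{K_i\cap\omega\ne\emptyset}\lambda_{l_i}^i,\qquad D_\omega=C_{\mathcal T}\,C_\pi^2\,(1+\Gamma_\omega),$$ with $\Lambda_\emptyset^{-1}=0$, where $C_{\mathcal T}$ is the square of the maximal number of vertices of a coarse cell and $$C_\pi=\sup_{K,\ \mu\in V_{\rm aux},\ \int_K\tilde\kappa\mu^2\neq0}\frac{\int_K\tilde\kappa\mu^2}{\int_K B\tilde\kappa\mu^2},$$ $K$ running over the coarse elements and $B$ being the bubble function of $K$. **Claim (exponential decay, constraint version).** Let $k_i\ge2$, let $\psi_j^i$ minimize $a(\psi,\psi)$ over the $\phi_j^i$-orthogonal $\psi\in V$, and let $\psi_{j,\rm ms}^i$ minimize $a(\psi,\psi)$ over the $\phi_j^i$-orthogonal $\psi\in V_0(K_{i,k_i})$. Then $$\|\psi_j^i-\psi_{j,\rm ms}^i\|_a^2\le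 E_i\,\|\phi_j^i\|_{s(K_i)}^2,\qquad E_i=8D_{K_{i,k_i}}^2\Big(1+\Lambda_{\Omega^\epsilon\setminus K_{i,k_i-1}}^{-1}\Big)\Bigg(1+\frac{\Lambda_{K_{i,k_i-1}}^{1/2}}{2D_{K_{i,k_i-1}}^{1/2}}\Bigg)^{1-k_i}.$$ -/

import Mathlib

open MeasureTheory
open scoped ContDiff

noncomputable section

namespace CEM

/-- Euclidean space `ℝ^d`. -/
abbrev Space (d : ℕ) : Type := EuclideanSpace ℝ (Fin d)

/-! ## Weak gradients and `H¹` -/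

/-- `g` is a weak gradient of `u` on the open set `U`. -/
def HasWeakGrad {d : ℕ} (U : Set (Space d)) (u : Space d → ℝ) (g : Space d → Space d) : Prop :=
  ∀ θ : Space d → ℝ, ContDiff ℝ ∞ θ → HasCompactSupport θ → tsupport θ ⊆ U →
    ∀ e : Space d,
      ∫ x in U, u x * fderiv ℝ θ x e = - ∫ x in U, inner ℝ (g x) e * θ x

/-- `g` is a square-integrable weak gradient of `u` on `U`. -/
def IsL2Grad {d : ℕ} (U : Set (Space d)) (u : Space d → ℝ) (g : Space d → Space d) : Prop :=
  MemLp g 2 (volume.restrict U) ∧ HasWeakGrad U u g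

/-- `u ∈ H¹(U)`. -/
def MemH1 {d : ℕ} (U : Set (Space d)) (u : Space d → ℝ) : Prop :=
  MemLp u 2 (volume.restrict U) ∧ ∃ g, IsL2Grad U u g

open Classical in
/-- The weak gradient on `U` (unique up to null sets) of a function in `H¹(U)`. -/
def weakGrad {d : ℕ} (U : Set (Space d)) (u : Space d → ℝ) : Space d → Space d :=
  if h : ∃ g, IsL2Grad U u g then h.choose else 0

/-- The energy form `∫_U ∇u · ∇v`. -/
def energy {d : ℕ} (U : Set (Space d)) (u v : Space d → ℝ) : ℝ :=
  ∫ x in U, inner ℝ (weakGrad U u x) (weakGrad U v x)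

/-! ## The coarse grid -/

/-- A conforming (face-to-face) grid of finitely many convex polytopes in `ℝ^d`; `ι` indexes the
elements and `ν` the vertices. -/
structure CoarseGrid (d : ℕ) (ι ν : Type*) where
  /-- position of a vertex -/
  vertex : ν → Space d
  /-- the vertices of an element -/
  verts : ι → Finset ν
  vertex_injective : Function.Injective vertex
  vertex_extreme : ∀ i, ∀ j ∈ verts i,
    vertex j ∈ (convexHull ℝ (vertex '' (verts i : Set ν))).extremePoints ℝ
  interior_nonempty : ∀ i, (interior (convexHull ℝ (vertex '' (verts i : Set ν)))).Nonempty
  interior_disjoint : ∀ i i', i ≠ i' →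
    Disjoint (interior (convexHull ℝ (vertex '' (verts i : Set ν))))
      (interior (convexHull ℝ (vertex '' (verts i' : Set ν))))
  conforming : ∀ i i',
    convexHull ℝ (vertex '' (verts i : Set ν)) ∩ convexHull ℝ (vertex '' (verts i' : Set ν)) =
      convexHull ℝ (vertex '' ((verts i : Set ν) ∩ (verts i' : Set ν)))

namespace CoarseGrid

variable {d : ℕ} {ι ν : Type*} (G : CoarseGrid d ι ν)

/-- The closed (unperforated) element. -/
def cell (i : ι) : Set (Space d) := convexHull ℝ (G.vertex '' (G.verts i : Set ν))

/-- The closed region covered by the grid. -/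
def region : Set (Space d) := ⋃ i, G.cell i

/-- Indices of the elements reached from element `i` by adding `m` layers of elements. -/
def layer (i : ι) : ℕ → Set ι
  | 0 => {i}
  | m + 1 => {j | ∃ j' ∈ layer i m, (G.cell j ∩ G.cell j').Nonempty}

end CoarseGrid

/-- A coarse grid, finitely many perforations (closed balls, given by centre and radius), and a
partition of unity attached to the vertices of the grid. The linear, bilinear and trilinear
Lagrange bases are the typical partitions of unity. -/
structure PerforatedGrid (d : ℕ) (ι ν : Type*) [Fintype ν] extends CoarseGrid d ι ν where
  /-- centres and radii of the perforations -/
  balls : Finset (Space d × ℝ)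
  radius_pos : ∀ p ∈ balls, 0 < p.2
  /-- partition of unity -/
  chi : ν → Space d → ℝ
  chi_lipschitz : ∀ j, ∃ C, LipschitzOnWith C (chi j) toCoarseGrid.region
  chi_nonneg : ∀ j, ∀ x ∈ toCoarseGrid.region, 0 ≤ chi j x
  chi_le_one : ∀ j, ∀ x ∈ toCoarseGrid.region, chi j x ≤ 1
  chi_sum : ∀ x ∈ toCoarseGrid.region, ∑ j, chi j x = 1
  chi_support : ∀ i, ∀ j ∉ verts i, ∀ x ∈ toCoarseGrid.cell i, chi j x = 0
  bubble_pos : ∀ i, ∀ x ∈ interior (toCoarseGrid.cell i), 0 < ∏ j ∈ verts i, chi j x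
  bubble_zero : ∀ i, ∀ x ∈ frontier (toCoarseGrid.cell i), ∏ j ∈ verts i, chi j x = 0

namespace PerforatedGrid

variable {d : ℕ} {ι ν : Type*} [Fintype ν] (G : PerforatedGrid d ι ν)

/-- The union of the perforations. -/
def holes : Set (Space d) := ⋃ p ∈ G.balls, Metric.closedBall p.1 p.2

/-- The perforated domain `Ω^ε = Ω \ B^ε`, with `Ω` the interior of the region of the grid. -/
def dom : Set (Space d) := interior G.region \ G.holes

/-- The (open, perforated) coarse element `K_i`. -/
def elem (i : ι) : Set (Space d) := interior (G.cell i) \ G.holes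

/-- The oversampled region `K_{i,m}`: `K_i` enlarged by `m` layers of coarse elements. -/
def oversample (i : ι) (m : ℕ) : Set (Space d) :=
  interior (⋃ j ∈ G.layer i m, G.cell j) \ G.holes

/-- For `U = Ω^ε` the space `V`, for `U = K_{i,m}` the space `V_0(K_{i,m})`: the functions in
`H¹(U)` that vanish on the part of `∂U` that is not on the perforations. Functions on `U` are
identified with their extensions by zero, and the boundary condition says that the extension by
zero is an `H¹` function away from the perforations, i.e. it has no jump across `∂U` there. -/
def MemV (U : Set (Space d)) (v : Space d → ℝ) : Prop :=
  (∀ x ∉ U, v x = 0) ∧ MemH1 (Set.univ \ G.holes) v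

/-- The weight `κ̃ = ∑_j |∇χ_j|²`. -/
def kappa (x : Space d) : ℝ := ∑ j, ‖gradient (G.chi j) x‖ ^ 2

/-- The bubble function of an element, the product of the `χ_j` over its vertices. -/
def bubble (i : ι) (x : Space d) : ℝ := ∏ j ∈ G.verts i, G.chi j x

/-- `s_i(u, v) = ∫_{K_i} κ̃ u v`. -/
def sLoc (i : ι) (u v : Space d → ℝ) : ℝ := ∫ x in G.elem i, G.kappa x * u x * v x

/-- `s(u, v) = ∑_i s_i(u, v)`. -/
def sForm [Fintype ι] (u v : Space d → ℝ) : ℝ := ∑ i, G.sLoc i u v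

/-- The `n`-th eigenvalue (`n = 1, 2, …`, ascending, counted with multiplicity) of the problem
`a_i(φ, v) = λ s_i(φ, v)` for all `v ∈ H¹(K_i)`, given by the Courant–Fischer min-max principle:
the infimum of the `t` such that `a_i ≤ t s_i` on some `n`-dimensional subspace of `H¹(K_i)` on
which `s_i` is positive definite. -/
def eigenvalue (i : ι) (n : ℕ) : ℝ :=
  sInf {t : ℝ | ∃ W : Submodule ℝ (Space d → ℝ), Module.finrank ℝ W = n ∧
    (∀ v ∈ W, MemH1 (G.elem i) v) ∧
    (∀ v ∈ W, v ≠ 0 → 0 < G.sLoc i v v) ∧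
    ∀ v ∈ W, energy (G.elem i) v v ≤ t * G.sLoc i v v}

/-- `φ i 0, …, φ i (l i - 1)` are `s_i`-orthonormal eigenfunctions, extended by zero, for the first
`l i ≥ 1` eigenvalues on `K_i`. -/
structure IsAuxBasis (l : ι → ℕ) (φ : (i : ι) → Fin (l i) → Space d → ℝ) : Prop where
  one_le : ∀ i, 1 ≤ l i
  memH1 : ∀ i j, MemH1 (G.elem i) (φ i j)
  zero_off : ∀ i j, ∀ x ∉ G.elem i, φ i j x = 0
  orthonormal : ∀ i j j', G.sLoc i (φ i j) (φ i j') = if j = j' then 1 else 0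
  eigen : ∀ i j, ∀ v, MemH1 (G.elem i) v →
    energy (G.elem i) (φ i j) v = G.eigenvalue i (j + 1) * G.sLoc i (φ i j) v

/-- `Λ_S = min {λ_{l_i+1}^i : K_i ∩ S ≠ ∅}` (the junk value for `S = ∅` is `0`, so that
`Λ_∅⁻¹ = 0`, in accordance with `min ∅ = ∞`). -/
def Lam (l : ι → ℕ) (S : Set (Space d)) : ℝ :=
  sInf {t | ∃ i, (G.elem i ∩ S).Nonempty ∧ t = G.eigenvalue i (l i + 1)}

/-- `Γ_S = max {λ_{l_i}^i : K_i ∩ S ≠ ∅}`. -/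
def Gam (l : ι → ℕ) (S : Set (Space d)) : ℝ :=
  sSup {t | ∃ i, (G.elem i ∩ S).Nonempty ∧ t = G.eigenvalue i (l i)}

/-- The auxiliary space `V_aux`, spanned by all the `φ_j^i`. -/
def Vaux {l : ι → ℕ} (φ : (i : ι) → Fin (l i) → Space d → ℝ) : Submodule ℝ (Space d → ℝ) :=
  Submodule.span ℝ {f | ∃ i j, f = φ i j}

/-- `C_π`, the supremum of `∫_K κ̃ μ² / ∫_K B κ̃ μ²` over the coarse elements `K` and the
`μ ∈ V_aux` that do not vanish on `K`. -/
def Cpi {l : ι → ℕ} (φ : (i : ι) → Fin (l i) → Space d → ℝ) : ℝ :=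
  sSup {r | ∃ i, ∃ μ ∈ Vaux φ, G.sLoc i μ μ ≠ 0 ∧
    r = G.sLoc i μ μ / ∫ x in G.elem i, G.bubble i x * G.kappa x * μ x ^ 2}

/-- `C_𝒯`, the square of the maximal number of vertices of a coarse element. -/
def CT [Fintype ι] : ℕ := (Finset.univ.sup fun i => (G.verts i).card) ^ 2

/-- `D_S = C_𝒯 C_π² (1 + Γ_S)`. -/
def Dconst [Fintype ι] {l : ι → ℕ} (φ : (i : ι) → Fin (l i) → Space d → ℝ)
    (S : Set (Space d)) : ℝ :=
  G.CT * G.Cpi φ ^ 2 * (1 + G.Gam l S)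

/-- `ψ` is `φ_j^i`-orthogonal. -/
def IsOrth [Fintype ι] {l : ι → ℕ} (φ : (i : ι) → Fin (l i) → Space d → ℝ) (i : ι)
    (j : Fin (l i)) (ψ : Space d → ℝ) : Prop :=
  G.sForm ψ (φ i j) = 1 ∧
    ∀ (i' : ι) (j' : Fin (l i')), (⟨i', j'⟩ : (i : ι) × Fin (l i)) ≠ ⟨i, j⟩ →
      G.sForm ψ (φ i' j') = 0

/-- `ψ` minimizes `a(ψ, ψ)` among the `φ_j^i`-orthogonal functions in `V` (for `U = Ω^ε`) or in
`V_0(K_{i,m})` (for `U = K_{i,m}`). -/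
def IsMinimizer [Fintype ι] {l : ι → ℕ} (φ : (i : ι) → Fin (l i) → Space d → ℝ) (i : ι)
    (j : Fin (l i)) (U : Set (Space d)) (ψ : Space d → ℝ) : Prop :=
  G.MemV U ψ ∧ G.IsOrth φ i j ψ ∧
    ∀ ψ', G.MemV U ψ' → G.IsOrth φ i j ψ' → energy G.dom ψ ψ ≤ energy G.dom ψ' ψ'

/-- `E_i` for oversampling by `k` layers. -/
def decay [Fintype ι] {l : ι → ℕ} (φ : (i : ι) → Fin (l i) → Space d → ℝ) (i : ι) (k : ℕ) : ℝ :=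
  8 * G.Dconst φ (G.oversample i k) ^ 2 * (1 + (G.Lam l (G.dom \ G.oversample i (k - 1)))⁻¹) *
    (1 + √(G.Lam l (G.oversample i (k - 1))) / (2 * √(G.Dconst φ (G.oversample i (k - 1))))) ^ (1 - (k : ℤ))

end PerforatedGrid

end CEM

end

noncomputable section

namespace CEM

open Filter Topology

/-! The two minimizers are compared through one test function, and the decay comes from applying the
same construction layer by layer.

Let `ξ` be a cutoff that is `0` on `m` layers around `K_i` and `1` beyond `m + 1` layers. The
product `ξψ` is already `s`-orthogonal to every `φ` off the ring of cells between: inside it is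
zero, outside it is `ψ`. On each ring cell a function `B μ`, with `B` the bubble and `μ` in the
local auxiliary space, removes the remaining components. This gives `Z = ξψ - β`, orthogonal to
`V_aux` and equal to `ψ` outside the larger region (`exists_test`). The correction is cheap because
the bubble pairing is positive definite on the local auxiliary space, quantified by `C_π`, while the
gradient of `μ` is controlled by `λ_{l_k}` and that of `B` by `κ̃` (`exists_lift`).

Three facts about `Z` finish the proof. (1) Take `m = k_i - 1`. Then `v = ψms - ψ + Z` is admissible
as a variation for both minimizers, so `Z = (ψ - ψms) + v` is an orthogonal splitting and the error
is at most `‖Z‖_a²` (`energy_sub_le`). (2) Off `K_i` the function `ψ` is orthogonal to the first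
`l_k` eigenfunctions, so the spectral gap gives a Poincaré inequality (`poincare`). With it `‖Z‖_a²`
is bounded by the energy of `ψ` outside `m` layers (`energy_test_le`). (3) For every `m`, `a(ψ, Z) =
0`. Outside the ring this product is the outer energy, and in the ring it is at least `-c` times the
ring energy, with `c = 2√D/√Λ`. Hence the outer energy shrinks by the factor `1 + 1/c` per layer
(`outerEnergy_succ_le`). The starting value is `a(ψ, ψ)`, bounded by using the lift of `φ_j^i` as a
competitor (`IsMinimizer.energy_le`).

The chosen `weakGrad` is only determined almost everywhere, so the argument carries pairs of a
function and an explicit gradient (`IsH1`) and returns to `energy` through `energy_eq`. -/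

/-- `u ∈ H¹(U)` with weak gradient `g`. -/
def IsH1 {d : ℕ} (U : Set (Space d)) (u : Space d → ℝ) (g : Space d → Space d) : Prop :=
  MemLp u 2 (volume.restrict U) ∧ IsL2Grad U u g

/-! ### Dominated convergence against bounded, compactly supported factors -/

section Integration

lemma norm_mul_le_indicator {E : Type*} {h f : E → ℝ} {K : Set E} {M : ℝ} (hfK : ∀ x ∉ K, f x = 0)
    (hM : ∀ x, |f x| ≤ M) (x : E) : ‖h x * f x‖ ≤ K.indicator (fun x => M * |h x|) x := by
  by_cases hx : x ∈ K
  · rw [Set.indicator_of_mem hx, norm_mul, mul_comm]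
    exact mul_le_mul_of_nonneg_right (hM x) (abs_nonneg _)
  · rw [Set.indicator_of_notMem hx, hfK x hx]; simp

variable {E : Type*} [TopologicalSpace E] [T2Space E] [MeasurableSpace E] [BorelSpace E]
  {μ : Measure E}

lemma integrable_indicator_mul_abs {h : E → ℝ} {K : Set E} (hh : LocallyIntegrable h μ)
    (hK : IsCompact K) (M : ℝ) : Integrable (K.indicator fun x => M * |h x|) μ := by
  have h1 : IntegrableOn h K μ := hh.integrableOn_isCompact hK
  exact IntegrableOn.integrable_indicator (h1.abs.const_mul M) hK.measurableSet

lemma integrable_mul_of_bdd {h f : E → ℝ} {K : Set E} {M : ℝ} (hh : LocallyIntegrable h μ)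
    (hhm : AEStronglyMeasurable h μ) (hf : AEStronglyMeasurable f μ) (hK : IsCompact K)
    (hfK : ∀ x ∉ K, f x = 0) (hM : ∀ x, |f x| ≤ M) : Integrable (fun x => h x * f x) μ :=
  (integrable_indicator_mul_abs hh hK M).mono' (hhm.mul hf)
    (Eventually.of_forall (norm_mul_le_indicator hfK hM))

lemma tendsto_integral_mul_of_bdd {h f : E → ℝ} {F : ℕ → E → ℝ} {K : Set E} {M : ℝ}
    (hh : LocallyIntegrable h μ)
    (hhm : AEStronglyMeasurable h μ) (hF : ∀ n, AEStronglyMeasurable (F n) μ) (hK : IsCompact K)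
    (hFK : ∀ n, ∀ x ∉ K, F n x = 0) (hM : ∀ n x, |F n x| ≤ M)
    (hlim : ∀ᵐ x ∂μ, Tendsto (fun n => F n x) atTop (𝓝 (f x))) :
    Tendsto (fun n => ∫ x, h x * F n x ∂μ) atTop (𝓝 (∫ x, h x * f x ∂μ)) := by
  refine tendsto_integral_of_dominated_convergence _ (fun n => hhm.mul (hF n))
    (integrable_indicator_mul_abs hh hK M)
    (fun n => Eventually.of_forall (norm_mul_le_indicator (hFK n) (hM n))) ?_
  filter_upwards [hlim] with x hx using hx.const_mul _

end Integration

/-! ### Calculus of weak gradients -/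

section WeakGradient

variable {d : ℕ} {U U' : Set (Space d)} {u v : Space d → ℝ} {g g' : Space d → Space d}

lemma locallyIntegrable_restrict_of_memLp {F : Type*} [NormedAddCommGroup F] {f : Space d → F}
    (h : MemLp f 2 (volume.restrict U)) : LocallyIntegrable f (volume.restrict U) :=
  h.locallyIntegrable (by norm_num)

lemma IsH1.memH1 (h : IsH1 U u g) : MemH1 U u := ⟨h.1, g, h.2⟩

lemma MemH1.exists_isH1 (h : MemH1 U u) : ∃ g, IsH1 U u g := h.2.imp fun _ hg => ⟨h.1, hg⟩

lemma IsH1.memLp_inner (h : IsH1 U u g) (e : Space d) :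
    MemLp (fun x => inner ℝ (g x) e) 2 (volume.restrict U) := h.2.1.inner_const e

lemma integrable_mul_test {h θ : Space d → ℝ} (hh : MemLp h 2 (volume.restrict U))
    (hθ : Continuous θ) (hc : HasCompactSupport θ) :
    Integrable (fun x => h x * θ x) (volume.restrict U) := by
  obtain ⟨M, hM⟩ := hc.exists_bound_of_continuous hθ
  exact integrable_mul_of_bdd (locallyIntegrable_restrict_of_memLp hh) hh.1 hθ.aestronglyMeasurable hc
    (fun x hx => image_eq_zero_of_notMem_tsupport hx) hM

lemma continuous_fderiv_apply_of_smooth {θ : Space d → ℝ} (hθ : ContDiff ℝ ∞ θ) (e : Space d) :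
    Continuous fun x => fderiv ℝ θ x e :=
  (hθ.continuous_fderiv (by simp)).clm_apply continuous_const

lemma hasCompactSupport_fderiv_apply {θ : Space d → ℝ} (hc : HasCompactSupport θ) (e : Space d) :
    HasCompactSupport fun x => fderiv ℝ θ x e := hc.fderiv_apply ℝ e

lemma IsH1.add (hu : IsH1 U u g) (hv : IsH1 U v g') : IsH1 U (u + v) (g + g') := by
  refine ⟨hu.1.add hv.1, hu.2.1.add hv.2.1, fun θ h1 h2 h3 e => ?_⟩
  have c1 := continuous_fderiv_apply_of_smooth h1 e
  have c2 := hasCompactSupport_fderiv_apply h2 e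
  have e1 : (fun x => (u + v) x * fderiv ℝ θ x e) =
    fun x => u x * fderiv ℝ θ x e + v x * fderiv ℝ θ x e := by ext x; simp [add_mul]
  have e2 : (fun x => inner ℝ ((g + g') x) e * θ x) =
    fun x => inner ℝ (g x) e * θ x + inner ℝ (g' x) e * θ x := by
      ext x; simp [inner_add_left, add_mul]
  rw [e1, e2, integral_add (integrable_mul_test hu.1 c1 c2) (integrable_mul_test hv.1 c1 c2),
    integral_add (integrable_mul_test (hu.memLp_inner e) h1.continuous h2)
      (integrable_mul_test (hv.memLp_inner e) h1.continuous h2),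
    hu.2.2 θ h1 h2 h3 e, hv.2.2 θ h1 h2 h3 e, neg_add]

lemma IsH1.smul (c : ℝ) (hu : IsH1 U u g) : IsH1 U (c • u) (c • g) := by
  refine ⟨hu.1.const_smul c, hu.2.1.const_smul c, fun θ h1 h2 h3 e => ?_⟩
  simp only [Pi.smul_apply, smul_eq_mul, real_inner_smul_left, mul_assoc]
  rw [integral_const_mul, integral_const_mul, hu.2.2 θ h1 h2 h3 e, mul_neg]

lemma IsH1.zero : IsH1 U (0 : Space d → ℝ) 0 :=
  ⟨MemLp.zero, MemLp.zero, fun θ _ _ _ e => by simp⟩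

lemma IsH1.neg (hu : IsH1 U u g) : IsH1 U (-u) (-g) := by simpa using hu.smul (-1)

lemma IsH1.sub (hu : IsH1 U u g) (hv : IsH1 U v g') : IsH1 U (u - v) (g - g') := by
  simpa [sub_eq_add_neg] using hu.add hv.neg

lemma IsH1.sum {κ : Type*} (s : Finset κ) {u : κ → Space d → ℝ} {g : κ → Space d → Space d}
    (h : ∀ k ∈ s, IsH1 U (u k) (g k)) : IsH1 U (∑ k ∈ s, u k) (∑ k ∈ s, g k) := by
  classical
  induction s using Finset.induction_on with
  | empty => simpa using IsH1.zero
  | insert a s ha ih =>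
    rw [Finset.sum_insert ha, Finset.sum_insert ha]
    exact (h a (by simp)).add (ih fun k hk => h k (by simp [hk]))

lemma setIntegral_eq_of_zero_off {f : Space d → ℝ} (hU : MeasurableSet U) (h : U' ⊆ U)
    (hf : ∀ x ∉ U', f x = 0) : ∫ x in U, f x = ∫ x in U', f x :=
  setIntegral_eq_of_subset_of_forall_sdiff_eq_zero hU h fun x hx => hf x hx.2

lemma IsH1.mono (hU : IsOpen U) (hUU' : U' ⊆ U) (h : IsH1 U u g) : IsH1 U' u g := by
  have hr : volume.restrict U' ≤ volume.restrict U := Measure.restrict_mono hUU' le_rfl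
  refine ⟨h.1.mono_measure hr, h.2.1.mono_measure hr, fun θ h1 h2 h3 e => ?_⟩
  rw [← setIntegral_eq_of_zero_off hU.measurableSet hUU', ← setIntegral_eq_of_zero_off
    hU.measurableSet hUU']
  · exact h.2.2 θ h1 h2 (h3.trans hUU') e
  · intro x hx
    rw [image_eq_zero_of_notMem_tsupport fun hx' => hx (h3 hx'), mul_zero]
  · intro x hx
    have : fderiv ℝ θ x = 0 :=
      image_eq_zero_of_notMem_tsupport fun hx' => hx (h3 (tsupport_fderiv_subset ℝ hx'))
    rw [this]; simp

lemma ae_eq_of_inner_ae_eq {μ : Measure (Space d)}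
    (h : ∀ e : Space d, ∀ᵐ x ∂μ, (inner ℝ (g x) e : ℝ) = inner ℝ (g' x) e) : g =ᵐ[μ] g' := by
  have := ae_all_iff.2 fun i : Fin d => h (EuclideanSpace.single i 1)
  filter_upwards [this] with x hx
  ext i
  simpa [EuclideanSpace.inner_single_right] using hx i

/-- Fundamental lemma of the calculus of variations, applied to each component of the difference. -/
lemma IsL2Grad.ae_eq (hU : IsOpen U) (h : IsL2Grad U u g) (h' : IsL2Grad U u g') :
    g =ᵐ[volume.restrict U] g' := by
  refine ae_eq_of_inner_ae_eq fun e => ?_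
  rw [ae_restrict_iff' hU.measurableSet]
  have l1 : MemLp (fun x => inner ℝ (g x) e) 2 (volume.restrict U) := h.1.inner_const e
  have l2 : MemLp (fun x => inner ℝ (g' x) e) 2 (volume.restrict U) := h'.1.inner_const e
  have hloc : LocallyIntegrableOn (fun x => inner ℝ (g x) e - inner ℝ (g' x) e) U volume := by
    apply LocallyIntegrableOn.sub
    · exact locallyIntegrableOn_of_locallyIntegrable_restrict (locallyIntegrable_restrict_of_memLp l1)
    · exact locallyIntegrableOn_of_locallyIntegrable_restrict (locallyIntegrable_restrict_of_memLp l2)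
  have := hU.ae_eq_zero_of_integral_contDiff_smul_eq_zero hloc fun θ h1 h2 h3 => ?_
  · filter_upwards [this] with x hx hxU using sub_eq_zero.1 (hx hxU)
  · rw [← setIntegral_eq_integral_of_forall_compl_eq_zero (s := U)]
    · have e1 := h.2 θ h1 h2 h3 e
      rw [h'.2 θ h1 h2 h3 e, neg_inj] at e1
      have : (fun x => θ x • ((inner ℝ (g x) e : ℝ) - inner ℝ (g' x) e)) =
        fun x => inner ℝ (g x) e * θ x - inner ℝ (g' x) e * θ x := by
          ext x; simp; ring
      rw [this, integral_sub (integrable_mul_test l1 h1.continuous h2)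
        (integrable_mul_test l2 h1.continuous h2), e1, sub_self]
    · intro x hx
      rw [image_eq_zero_of_notMem_tsupport fun hx' => hx (h3 hx'), zero_smul]

lemma IsH1.weakGrad_ae_eq (hU : IsOpen U) (h : IsH1 U u g) :
    weakGrad U u =ᵐ[volume.restrict U] g := by
  have hex : ∃ g, IsL2Grad U u g := ⟨g, h.2⟩
  unfold weakGrad
  rw [dif_pos hex]
  exact hex.choose_spec.ae_eq hU h.2

lemma energy_eq (hU : IsOpen U) (hu : IsH1 U u g) (hv : IsH1 U v g') :
    energy U u v = ∫ x in U, inner ℝ (g x) (g' x) := by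
  refine integral_congr_ae ?_
  filter_upwards [hu.weakGrad_ae_eq hU, hv.weakGrad_ae_eq hU] with x h1 h2
  rw [h1, h2]

end WeakGradient

/-! ### Lipschitz test functions and products with Lipschitz cutoffs -/

section Lipschitz

open scoped Convolution

variable {d : ℕ} {U U' : Set (Space d)} {u v : Space d → ℝ} {g g' : Space d → Space d}

/-- Differentiation under the integral sign: by Rademacher `f` is differentiable at `x - t` for
almost every `t`, and `|ρ| C` dominates the difference quotients. -/
lemma hasFDerivAt_convolution_of_lipschitz {C : NNReal} {f ρ : Space d → ℝ}
    (hf : LipschitzWith C f) (hρ : Continuous ρ) (hc : HasCompactSupport ρ) (x : Space d) :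
    HasFDerivAt (ρ ⋆[ContinuousLinearMap.lsmul ℝ ℝ, volume] f)
      ((ρ ⋆[ContinuousLinearMap.lsmul ℝ ℝ, volume] fderiv ℝ f) x) x := by
  have hρi : Integrable ρ := hρ.integrable_of_hasCompactSupport hc
  have hcont : ∀ x : Space d, Continuous fun t => ρ t * f (x - t) := fun x =>
    hρ.mul (hf.continuous.comp (continuous_const.sub continuous_id))
  have key := hasFDerivAt_integral_of_dominated_loc_of_lip (μ := (volume : Measure (Space d)))
    (F := fun x t => ρ t * f (x - t)) (F' := fun t => ρ t • fderiv ℝ f (x - t)) (x₀ := x)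
    (bound := fun t => |ρ t| * C) (s := Set.univ) univ_mem
    (Eventually.of_forall fun x => (hcont x).aestronglyMeasurable)
    ((hcont x).integrable_of_hasCompactSupport hc.mul_right)
    (hρ.aestronglyMeasurable.smul
      ((measurable_fderiv ℝ f).comp (measurable_const.sub measurable_id)).aestronglyMeasurable)
    (Eventually.of_forall fun t => ?_) (hρi.abs.mul_const _) ?_
  · exact key.2
  · refine LipschitzWith.lipschitzOnWith (LipschitzWith.of_dist_le_mul fun y z => ?_)
    rw [Real.dist_eq, ← mul_sub, abs_mul, Real.coe_nnabs, abs_of_nonneg (a := |ρ t| * C)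
      (mul_nonneg (abs_nonneg _) C.2), mul_assoc]
    refine mul_le_mul_of_nonneg_left ?_ (abs_nonneg _)
    have := hf.dist_le_mul (y - t) (z - t)
    rwa [Real.dist_eq, dist_sub_right] at this
  · have h1 := (quasiMeasurePreserving_sub_left_of_right_invariant (volume : Measure (Space d)) x).ae
      (hf.ae_differentiableAt)
    filter_upwards [h1] with t ht
    have h2 : HasFDerivAt (fun y => f (y - t)) (fderiv ℝ f (x - t)) x := by
      have := ht.hasFDerivAt
      exact (this.comp x ((hasFDerivAt_id x).sub_const t)).congr_fderiv (by ext; simp)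
    exact h2.const_mul (ρ t)

/-- Mollification reduces this to smooth test functions. The mollified gradients stay bounded by the
Lipschitz constant and converge almost everywhere, so dominated convergence passes to the limit. -/
lemma IsH1.integral_mul_fderiv_lipschitz {C : NNReal} {f : Space d → ℝ} (hU : IsOpen U)
    (h : IsH1 U u g) (hf : LipschitzWith C f) (hc : HasCompactSupport f) (hs : tsupport f ⊆ U)
    (e : Space d) :
    ∫ x in U, u x * fderiv ℝ f x e = - ∫ x in U, inner ℝ (g x) e * f x := by
  obtain ⟨δ, hδ, hδU⟩ := hc.isCompact.exists_cthickening_subset_open hU hs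
  set K := Metric.cthickening δ (tsupport f)
  have hK : IsCompact K := hc.isCompact.cthickening
  -- Outer radii at most `δ` keep all mollified supports in `K`. The fixed ratio 2 of outer to inner
  -- radius is what the Lebesgue differentiation theorem asks for below.
  let φ : ℕ → ContDiffBump (0 : Space d) := fun n =>
    ⟨δ / (n + 1) / 2, δ / (n + 1), by positivity, half_lt_self (by positivity)⟩
  let F : ℕ → Space d → ℝ := fun n => (φ n).normed volume ⋆[ContinuousLinearMap.lsmul ℝ ℝ, volume] f
  have hφ : Tendsto (fun n => (φ n).rOut) atTop (𝓝 0) :=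
    by simpa [φ, div_eq_mul_inv] using
      (tendsto_one_div_add_atTop_nhds_zero_nat (𝕜 := ℝ)).const_mul δ
  have hsmooth : ∀ n, ContDiff ℝ ∞ (F n) := fun n =>
    (φ n).hasCompactSupport_normed.contDiff_convolution_left _ (φ n).contDiff_normed
      hf.continuous.locallyIntegrable
  have hsuppK : ∀ n, Function.support (F n) ⊆ K := by
    intro n x hx
    obtain ⟨a, ha, b, hb, rfl⟩ := support_convolution_subset _ hx
    rw [(φ n).support_normed_eq] at ha
    refine Metric.mem_cthickening_of_dist_le (a + b) b _ _ (subset_tsupport f hb) ?_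
    have h1 : ‖a‖ < δ / (n + 1) := by simpa [φ] using ha
    have h2 : δ / ((n : ℝ) + 1) ≤ δ := div_le_self hδ.le (by linarith [Nat.cast_nonneg (α := ℝ) n])
    rw [dist_eq_norm, add_sub_cancel_right]
    linarith
  have htK : ∀ n, tsupport (F n) ⊆ K := fun n =>
    closure_minimal (hsuppK n) Metric.isClosed_cthickening
  have hcF : ∀ n, HasCompactSupport (F n) := fun n => hK.of_isClosed_subset (isClosed_tsupport _)
    (htK n)
  have hfd : ∀ n x, fderiv ℝ (F n) x =
      ((φ n).normed volume ⋆[ContinuousLinearMap.lsmul ℝ ℝ, volume] fderiv ℝ f) x := fun n x =>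
    (hasFDerivAt_convolution_of_lipschitz hf (φ n).continuous_normed
      (φ n).hasCompactSupport_normed x).fderiv
  obtain ⟨M, hM⟩ := hc.exists_bound_of_continuous hf.continuous
  have hfC : ∀ x, ‖fderiv ℝ f x‖ ≤ C := fun x => norm_fderiv_le_of_lipschitz ℝ hf
  have avg : ∀ {V : Type} [NormedAddCommGroup V] [NormedSpace ℝ V] (q : Space d → V) (B : ℝ)
      (_ : ∀ x, ‖q x‖ ≤ B) (n : ℕ) (x : Space d),
      ‖((φ n).normed volume ⋆[ContinuousLinearMap.lsmul ℝ ℝ, volume] q) x‖ ≤ B := by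
    intro V _ _ q B hq n x
    have h1 : ‖∫ t, (φ n).normed volume t • q (x - t)‖ ≤ ∫ t, (φ n).normed volume t * B := by
      refine norm_integral_le_of_norm_le ((φ n).integrable_normed.mul_const B)
        (Eventually.of_forall fun t => ?_)
      rw [norm_smul, Real.norm_of_nonneg ((φ n).nonneg_normed t)]
      exact mul_le_mul_of_nonneg_left (hq _) ((φ n).nonneg_normed t)
    rw [integral_mul_const, (φ n).integral_normed, one_mul] at h1
    exact h1
  have lim1 : Tendsto (fun n => ∫ x in U, u x * fderiv ℝ (F n) x e) atTop
      (𝓝 (∫ x in U, u x * fderiv ℝ f x e)) := by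
    refine tendsto_integral_mul_of_bdd (K := K) (M := C * ‖e‖)
      (locallyIntegrable_restrict_of_memLp h.1) h.1.1
      (fun n => (continuous_fderiv_apply_of_smooth (hsmooth n) e).aestronglyMeasurable) hK
      (fun n x hx => ?_) (fun n x => ?_) ?_
    · have : fderiv ℝ (F n) x = 0 := image_eq_zero_of_notMem_tsupport fun hx' =>
        hx (htK n (tsupport_fderiv_subset ℝ hx'))
      rw [this]; rfl
    · refine (ContinuousLinearMap.le_opNorm (fderiv ℝ (F n) x) e).trans
        (mul_le_mul_of_nonneg_right ?_ (norm_nonneg _))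
      rw [hfd]
      exact avg (fderiv ℝ f) C hfC n x
    · refine ae_restrict_of_ae ?_
      have hli : LocallyIntegrable (fderiv ℝ f) (volume : Measure (Space d)) :=
        (locallyIntegrable_const (C : ℝ)).mono
          (measurable_fderiv ℝ f).aestronglyMeasurable
          (Eventually.of_forall fun x => (hfC x).trans (le_abs_self _))
      filter_upwards [ContDiffBump.ae_convolution_tendsto_right_of_locallyIntegrable
        (K := 2) hφ (Eventually.of_forall fun n => le_of_eq (by simp [φ]; ring)) hli] with x hx
      have h2 := ((ContinuousLinearMap.apply ℝ ℝ e).continuous.tendsto _).comp hx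
      refine h2.congr fun n => ?_
      simp only [Function.comp, hfd]
      rfl
  have lim2 : Tendsto (fun n => ∫ x in U, inner ℝ (g x) e * F n x) atTop
      (𝓝 (∫ x in U, inner ℝ (g x) e * f x)) := by
    refine tendsto_integral_mul_of_bdd (K := K) (M := M)
      (locallyIntegrable_restrict_of_memLp (h.memLp_inner e)) (h.memLp_inner e).1
      (fun n => (hsmooth n).continuous.aestronglyMeasurable) hK
      (fun n x hx => ?_) (fun n x => avg f M hM n x)
      (Eventually.of_forall fun x =>
        ContDiffBump.convolution_tendsto_right_of_continuous hφ hf.continuous x)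
    exact image_eq_zero_of_notMem_tsupport fun hx' => hx (htK n hx')
  refine tendsto_nhds_unique lim1 (lim2.neg.congr fun n => ?_)
  exact (h.2.2 (F n) (hsmooth n) (hcF n) ((htK n).trans hδU) e).symm

lemma lipschitzWith_mul_of_bdd {A B : NNReal} {p q : Space d → ℝ} {M : NNReal}
    (hp : LipschitzWith A p) (hq : LipschitzWith B q) (hp1 : ∀ x, |p x| ≤ 1)
    (hqM : ∀ x, |q x| ≤ M) : LipschitzWith (A * M + B) fun x => p x * q x := by
  refine LipschitzWith.of_dist_le_mul fun x y => ?_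
  have h1 := hp.dist_le_mul x y
  have h2 := hq.dist_le_mul x y
  rw [Real.dist_eq] at h1 h2 ⊢
  have e : p x * q x - p y * q y = (p x - p y) * q x + p y * (q x - q y) := by ring
  rw [e]
  refine (abs_add_le _ _).trans ?_
  rw [abs_mul, abs_mul]
  have h3 := mul_le_mul h1 (hqM x) (abs_nonneg _) (by positivity)
  have h4 := mul_le_mul (hp1 y) h2 (abs_nonneg _) zero_le_one
  push_cast
  linarith

lemma lipschitzWith_posPart_sub {C : NNReal} {b : Space d → ℝ} (hb : LipschitzWith C b) (ε : ℝ) :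
    LipschitzWith C fun x => max (b x - ε) 0 := by
  refine LipschitzWith.of_dist_le_mul fun x y => ?_
  have h1 := hb.dist_le_mul x y
  refine le_trans ?_ h1
  rw [Real.dist_eq, Real.dist_eq]
  simpa using abs_max_sub_max_le_abs (b x - ε) (b y - ε) 0

/-- Where `b x ≤ ε` the truncation attains its minimum, so `fderiv` is zero there, whether or not
the truncation is differentiable. -/
lemma fderiv_posPart_sub {b : Space d → ℝ} {ε : ℝ} {x : Space d} (hb : Continuous b) :
    fderiv ℝ (fun x => max (b x - ε) 0) x = if ε < b x then fderiv ℝ b x else 0 := by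
  split_ifs with h
  · have : (fun x => max (b x - ε) 0) =ᶠ[𝓝 x] fun x => b x - ε := by
      filter_upwards [hb.tendsto x |>.eventually (lt_mem_nhds h)] with y hy
      exact max_eq_left (by linarith)
    rw [this.fderiv_eq, fderiv_sub_const]
  · apply IsLocalMin.fderiv_eq_zero
    refine Eventually.of_forall fun y => ?_
    simp only
    rw [max_eq_right (by linarith : b x - ε ≤ 0)]
    exact le_max_right _ _

lemma measurable_gradient (b : Space d → ℝ) : Measurable (gradient b) := by
  unfold gradient
  exact (LinearIsometryEquiv.continuous _).measurable.comp (measurable_fderiv ℝ b)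

lemma norm_gradient (b : Space d → ℝ) (x : Space d) : ‖gradient b x‖ = ‖fderiv ℝ b x‖ := by
  rw [gradient, LinearIsometryEquiv.norm_map]

/-- Product rule combined with extension by zero, with no regularity of the boundary of `U`. If `θ`
is a test function on `U'`, then `(b - ε)₊ θ` is a Lipschitz test function supported in `U`; the
identity for `b` follows as `ε → 0`. It serves both the bubbles (from an element to the complement
of the holes) and the cutoffs (with `U = U'`). -/
lemma IsH1.mul_lipschitz {C : NNReal} {b : Space d → ℝ} (hU : IsOpen U) (hU' : IsOpen U')
    (hUU' : U ⊆ U') (h : IsH1 U u g) (hb : LipschitzWith C b) (b0 : ∀ x, 0 ≤ b x)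
    (b1 : ∀ x, b x ≤ 1) (hbz : ∀ x ∈ U', x ∉ U → b x = 0) :
    IsH1 U' (fun x => b x * u x) (U.indicator fun x => b x • g x + u x • gradient b x) := by
  have habs : ∀ x, |b x| ≤ 1 := fun x => by rw [abs_of_nonneg (b0 x)]; exact b1 x
  have hgb : ∀ x, ‖gradient b x‖ ≤ C := fun x => by
    rw [norm_gradient]; exact norm_fderiv_le_of_lipschitz ℝ hb
  have hUm := hU.measurableSet
  have m1 : MemLp (fun x => b x * u x) 2 (volume.restrict U) :=
    MemLp.of_le h.1 (hb.continuous.aestronglyMeasurable.mul h.1.1) (Eventually.of_forall fun x => by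
      rw [norm_mul]; exact mul_le_of_le_one_left (norm_nonneg _) (habs x))
  have m2 : MemLp (fun x => b x • g x) 2 (volume.restrict U) :=
    MemLp.of_le h.2.1 (hb.continuous.aestronglyMeasurable.smul h.2.1.1)
      (Eventually.of_forall fun x => by
        rw [norm_smul]; exact mul_le_of_le_one_left (norm_nonneg _) (habs x))
  have m3 : MemLp (fun x => u x • gradient b x) 2 (volume.restrict U) :=
    MemLp.of_le_mul h.1 (c := C) (h.1.1.smul (measurable_gradient b).aestronglyMeasurable)
      (Eventually.of_forall fun x => by
        rw [norm_smul, mul_comm]; exact mul_le_mul_of_nonneg_right (hgb x) (norm_nonneg _))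
  have hrr : (volume.restrict U').restrict U = volume.restrict U := by
    rw [Measure.restrict_restrict hUm, Set.inter_eq_left.2 hUU']
  refine ⟨?_, (memLp_indicator_iff_restrict hUm).2 (by rw [hrr]; exact m2.add m3), ?_⟩
  · have e : (fun x => b x * u x) =ᵐ[volume.restrict U'] U.indicator fun x => b x * u x := by
      refine ae_restrict_of_forall_mem hU'.measurableSet fun x hx => ?_
      by_cases hxU : x ∈ U
      · rw [Set.indicator_of_mem hxU]
      · rw [Set.indicator_of_notMem hxU]; simp [hbz x hx hxU]
    exact (memLp_congr_ae e).2 ((memLp_indicator_iff_restrict hUm).2 (by rwa [hrr]))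
  intro θ h1 h2 h3 e
  obtain ⟨B, hB⟩ := h1.lipschitzWith_of_hasCompactSupport h2 (by simp)
  obtain ⟨M', hM'⟩ := h2.exists_bound_of_continuous h1.continuous
  set M : NNReal := M'.toNNReal
  have hM : ∀ x, |θ x| ≤ M := fun x => (hM' x).trans (Real.le_coe_toNNReal _)
  let ε : ℕ → ℝ := fun n => 1 / ((n : ℝ) + 1)
  have hε0 : ∀ n, 0 < ε n := fun n => by positivity
  have hεl : Tendsto ε atTop (𝓝 0) := tendsto_one_div_add_atTop_nhds_zero_nat
  let p : ℕ → Space d → ℝ := fun n x => max (b x - ε n) 0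
  have hpL : ∀ n, LipschitzWith C (p n) := fun n => lipschitzWith_posPart_sub hb _
  have hp1 : ∀ n x, |p n x| ≤ 1 := fun n x => by
    rw [abs_of_nonneg (le_max_right _ _)]
    exact max_le (by linarith [b1 x, hε0 n]) zero_le_one
  let f : ℕ → Space d → ℝ := fun n x => p n x * θ x
  have hfL : ∀ n, LipschitzWith (C * M + B) (f n) := fun n =>
    lipschitzWith_mul_of_bdd (hpL n) hB (hp1 n) hM
  have hts : ∀ n, tsupport (f n) ⊆ tsupport θ := fun n => tsupport_mul_subset_right
  -- The closed set `{ε ≤ b}` contains the support, and `b` vanishes on `U' \ U`.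
  have htU : ∀ n, tsupport (f n) ⊆ U := by
    intro n x hx
    have hxU' := h3 (hts n hx)
    by_contra hxU
    have hcl : tsupport (f n) ⊆ {x | ε n ≤ b x} := by
      refine closure_minimal (fun y hy => ?_) (isClosed_le continuous_const hb.continuous)
      by_contra hlt
      have : p n y = 0 := max_eq_right (by simp only [Set.mem_ofPred_eq, not_le] at hlt; linarith)
      exact hy (by simp [f, this])
    have := hcl hx
    simp only [Set.mem_ofPred_eq, hbz x hxU' hxU] at this
    exact absurd this (not_le.2 (hε0 n))
  have hfc : ∀ n, HasCompactSupport (f n) := fun n => h2.mul_left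
  have hplim : ∀ x, Tendsto (fun n => p n x) atTop (𝓝 (b x)) := by
    intro x
    have : Tendsto (fun n => max (b x - ε n) 0) atTop (𝓝 (max (b x - 0) 0)) :=
      (tendsto_const_nhds.sub hεl).max tendsto_const_nhds
    simpa [max_eq_left (b0 x)] using this
  have lim1 : Tendsto (fun n => ∫ x in U, u x * fderiv ℝ (f n) x e) atTop
      (𝓝 (∫ x in U, u x * (b x * fderiv ℝ θ x e + fderiv ℝ b x e * θ x))) := by
    refine tendsto_integral_mul_of_bdd (K := tsupport θ) (M := (C * M + B) * ‖e‖)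
      (locallyIntegrable_restrict_of_memLp h.1) h.1.1
      (fun n => (measurable_fderiv_apply_const ℝ (f n) e).aestronglyMeasurable) h2
      (fun n x hx => ?_) (fun n x => ?_) ?_
    · have : fderiv ℝ (f n) x = 0 := image_eq_zero_of_notMem_tsupport fun hx' =>
        hx (hts n (tsupport_fderiv_subset ℝ hx'))
      rw [this]; rfl
    · refine (ContinuousLinearMap.le_opNorm (fderiv ℝ (f n) x) e).trans
        (mul_le_mul_of_nonneg_right ?_ (norm_nonneg _))
      exact_mod_cast norm_fderiv_le_of_lipschitz ℝ (hfL n)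
    · refine ae_restrict_of_ae ?_
      filter_upwards [ae_all_iff.2 fun n => (hpL n).ae_differentiableAt] with x hx
      have hd : ∀ n, fderiv ℝ (f n) x e = p n x * fderiv ℝ θ x e +
          (if ε n < b x then fderiv ℝ b x e else 0) * θ x := by
        intro n
        have := ((hx n).hasFDerivAt.mul (h1.differentiable (by simp) x).hasFDerivAt).fderiv
        have h5 : fderiv ℝ (f n) x = p n x • fderiv ℝ θ x + θ x • fderiv ℝ (p n) x := this
        rw [h5, fderiv_posPart_sub hb.continuous]
        split_ifs <;> simp [mul_comm]
      simp_rw [hd]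
      refine ((hplim x).mul_const _).add (Tendsto.mul_const _ ?_)
      -- At a zero of `b` the truncated derivatives are all zero; the limit agrees because `b` has a
      -- minimum there and its own derivative vanishes.
      rcases (b0 x).eq_or_lt with h0 | h0
      · have : fderiv ℝ b x = 0 := IsLocalMin.fderiv_eq_zero
          (Eventually.of_forall fun y => by rw [← h0]; exact b0 y)
        rw [this]; simp
      · refine tendsto_const_nhds.congr' ?_
        filter_upwards [hεl.eventually (gt_mem_nhds h0)] with n hn
        rw [if_pos hn]
  have lim2 : Tendsto (fun n => ∫ x in U, inner ℝ (g x) e * f n x) atTop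
      (𝓝 (∫ x in U, inner ℝ (g x) e * (b x * θ x))) := by
    refine tendsto_integral_mul_of_bdd (K := tsupport θ) (M := M)
      (locallyIntegrable_restrict_of_memLp (h.memLp_inner e)) (h.memLp_inner e).1
      (fun n => (hfL n).continuous.aestronglyMeasurable) h2
      (fun n x hx => ?_) (fun n x => ?_)
      (Eventually.of_forall fun x => (hplim x).mul_const _)
    · exact image_eq_zero_of_notMem_tsupport fun hx' => hx (hts n hx')
    · rw [abs_mul]
      exact (mul_le_of_le_one_left (abs_nonneg _) (hp1 n x)).trans (hM x)
  have key := tendsto_nhds_unique lim1 (lim2.neg.congr fun n =>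
    (h.integral_mul_fderiv_lipschitz hU (hfL n) (hfc n) (htU n) e).symm)
  have hθd := continuous_fderiv_apply_of_smooth h1 e
  have hθc := hasCompactSupport_fderiv_apply h2 e
  have i1 : Integrable (fun x => (b x * u x) * fderiv ℝ θ x e) (volume.restrict U) :=
    integrable_mul_test m1 hθd hθc
  have i2 : Integrable (fun x => inner ℝ (u x • gradient b x) e * θ x) (volume.restrict U) :=
    integrable_mul_test (m3.inner_const e) h1.continuous h2
  have i3 : Integrable (fun x => inner ℝ (b x • g x) e * θ x) (volume.restrict U) :=
    integrable_mul_test (m2.inner_const e) h1.continuous h2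
  have e1 : ∫ x in U, u x * (b x * fderiv ℝ θ x e + fderiv ℝ b x e * θ x) =
      (∫ x in U, (b x * u x) * fderiv ℝ θ x e) +
        ∫ x in U, inner ℝ (u x • gradient b x) e * θ x := by
    rw [← integral_add i1 i2]
    congr 1 with x
    rw [real_inner_smul_left, inner_gradient_left]; ring
  have e2 : ∫ x in U', b x * u x * fderiv ℝ θ x e = ∫ x in U, b x * u x * fderiv ℝ θ x e :=
    setIntegral_eq_of_subset_of_forall_sdiff_eq_zero hU'.measurableSet hUU' fun x hx => by
      rw [hbz x hx.1 hx.2]; simp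
  have e3 : ∫ x in U', inner ℝ (U.indicator (fun x => b x • g x + u x • gradient b x) x) e * θ x =
      (∫ x in U, inner ℝ (b x • g x) e * θ x) +
        ∫ x in U, inner ℝ (u x • gradient b x) e * θ x := by
    rw [setIntegral_eq_of_zero_off hU'.measurableSet hUU', ← integral_add i3 i2]
    · refine setIntegral_congr_fun hUm fun x hx => ?_
      rw [Set.indicator_of_mem hx, inner_add_left, add_mul]
    · intro x hx
      rw [Set.indicator_of_notMem hx]; simp
  have e4 : ∫ x in U, inner ℝ (g x) e * (b x * θ x) = ∫ x in U, inner ℝ (b x • g x) e * θ x := by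
    congr 1 with x
    rw [real_inner_smul_left]; ring
  rw [e2, e3]
  rw [e1, e4] at key
  linarith

end Lipschitz

/-! ### Geometry of the grid, its layers and its perforations -/

namespace PerforatedGrid

variable {d : ℕ} {ι ν : Type*} [Fintype ν] (G : PerforatedGrid d ι ν)

lemma isCompact_cell (i : ι) : IsCompact (G.cell i) :=
  ((G.verts i).finite_toSet.image _).isCompact_convexHull ℝ

lemma isClosed_cell (i : ι) : IsClosed (G.cell i) := (G.isCompact_cell i).isClosed

lemma convex_cell (i : ι) : Convex ℝ (G.cell i) := convex_convexHull ℝ _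

lemma vertex_mem_cell {i : ι} {j : ν} (hj : j ∈ G.verts i) : G.vertex j ∈ G.cell i :=
  subset_convexHull ℝ _ ⟨j, hj, rfl⟩

lemma cell_subset_region (i : ι) : G.cell i ⊆ G.region := Set.subset_iUnion G.cell i

lemma isClosed_holes : IsClosed G.holes :=
  G.balls.finite_toSet.isClosed_biUnion fun _ _ => Metric.isClosed_closedBall

lemma isOpen_compl_holes : IsOpen (Set.univ \ G.holes) := isOpen_univ.sdiff G.isClosed_holes

lemma isOpen_elem (i : ι) : IsOpen (G.elem i) := isOpen_interior.sdiff G.isClosed_holes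

lemma isOpen_dom : IsOpen G.dom := isOpen_interior.sdiff G.isClosed_holes

lemma dom_subset : G.dom ⊆ Set.univ \ G.holes := Set.sdiff_subset_sdiff_left (Set.subset_univ _)

lemma elem_subset (i : ι) : G.elem i ⊆ Set.univ \ G.holes :=
  Set.sdiff_subset_sdiff_left (Set.subset_univ _)

lemma elem_subset_interior (i : ι) : G.elem i ⊆ interior (G.cell i) := Set.sdiff_subset

lemma elem_subset_cell (i : ι) : G.elem i ⊆ G.cell i :=
  (G.elem_subset_interior i).trans interior_subset

lemma elem_subset_dom (i : ι) : G.elem i ⊆ G.dom :=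
  Set.sdiff_subset_sdiff_left (interior_mono (G.cell_subset_region i))

/-- A convex body is the closure of its interior, so disjointness of the interiors passes to the
closed cell. -/
lemma disjoint_interior_cell {i j : ι} (h : i ≠ j) : Disjoint (interior (G.cell i)) (G.cell j) := by
  have h1 : Disjoint (interior (G.cell i)) (interior (G.cell j)) := G.interior_disjoint i j h
  have h2 := h1.closure_right isOpen_interior
  rwa [(G.convex_cell j).closure_interior_eq_closure_of_nonempty_interior (G.interior_nonempty j),
    (G.isClosed_cell j).closure_eq] at h2

lemma disjoint_elem_cell {i j : ι} (h : i ≠ j) : Disjoint (G.elem i) (G.cell j) :=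
  (G.disjoint_interior_cell h).mono_left (G.elem_subset_interior i)

lemma disjoint_elem {i j : ι} (h : i ≠ j) : Disjoint (G.elem i) (G.elem j) :=
  (G.disjoint_elem_cell h).mono_right (G.elem_subset_cell j)

lemma elem_subset_oversample {i j : ι} {m : ℕ} (h : j ∈ G.layer i m) :
    G.elem j ⊆ G.oversample i m :=
  Set.sdiff_subset_sdiff_left (interior_mono (Set.subset_biUnion_of_mem (u := G.cell) h))

lemma disjoint_elem_oversample {i j : ι} {m : ℕ} (h : j ∉ G.layer i m) :
    Disjoint (G.elem j) (G.oversample i m) := by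
  refine Set.disjoint_left.2 fun x hx hx' => ?_
  obtain ⟨j', hj', hxj'⟩ := Set.mem_iUnion₂.1 (interior_subset hx'.1)
  have hne : j ≠ j' := fun h' => h (h' ▸ hj')
  exact Set.disjoint_left.1 (G.disjoint_elem_cell hne) hx hxj'

lemma oversample_subset_dom (i : ι) (m : ℕ) : G.oversample i m ⊆ G.dom :=
  Set.sdiff_subset_sdiff_left (interior_mono (Set.iUnion₂_subset fun j _ => G.cell_subset_region j))

lemma layer_subset_succ (i : ι) (m : ℕ) : G.layer i m ⊆ G.layer i (m + 1) := by
  intro j hj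
  refine ⟨j, hj, ?_⟩
  rw [Set.inter_self]
  exact (G.interior_nonempty j).mono interior_subset

lemma layer_mono (i : ι) : Monotone (G.layer i) := monotone_nat_of_le_succ (G.layer_subset_succ i)

lemma mem_layer_self (i : ι) (m : ℕ) : i ∈ G.layer i m :=
  G.layer_mono i (Nat.zero_le m) rfl

section Fintype

variable [Fintype ι]

/-- What is missing lies on frontiers of convex sets, which are null. This lets integrals over the
domain be split element by element. -/
lemma dom_ae_eq : (⋃ i, G.elem i : Set (Space d)) =ᵐ[volume] G.dom := by
  refine (ae_le_set.2 ?_).antisymm (ae_le_set.2 ?_)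
  · rw [Set.sdiff_eq_empty.2 (Set.iUnion_subset G.elem_subset_dom), measure_empty]
  · refine measure_mono_null (t := ⋃ i, frontier (G.cell i)) ?_
      (measure_iUnion_null fun i => (G.convex_cell i).addHaar_frontier volume)
    rintro x ⟨⟨h1, h2⟩, h3⟩
    obtain ⟨i, hi⟩ := Set.mem_iUnion.1 (interior_subset h1)
    refine Set.mem_iUnion.2 ⟨i, subset_closure hi, fun h4 => h3 (Set.mem_iUnion.2 ⟨i, h4, h2⟩)⟩

lemma setIntegral_dom {f : Space d → ℝ} (hf : IntegrableOn f G.dom) :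
    ∫ x in G.dom, f x = ∑ i, ∫ x in G.elem i, f x := by
  rw [← setIntegral_congr_set G.dom_ae_eq]
  exact integral_iUnion_fintype (fun i => (G.isOpen_elem i).measurableSet)
    (fun i j h => G.disjoint_elem h) fun i => hf.mono_set (G.elem_subset_dom i)

lemma isClosed_biUnion_cell (s : Set ι) : IsClosed (⋃ j ∈ s, G.cell j) :=
  s.toFinite.isClosed_biUnion fun j _ => G.isClosed_cell j

lemma mem_cell_of_notMem_oversample {i : ι} {m : ℕ} {x : Space d} (hx : x ∈ G.dom)
    (hx' : x ∉ G.oversample i m) : ∃ j ∉ G.layer i m, x ∈ G.cell j := by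
  by_contra! h
  refine hx' ⟨?_, hx.2⟩
  -- The cells off the layers have a closed union, so a point avoiding all of them has a whole
  -- neighbourhood covered by the layers and lies in the interior of their union.
  have h1 : interior G.region ∩ (⋃ j ∈ (G.layer i m)ᶜ, G.cell j)ᶜ ⊆ ⋃ j ∈ G.layer i m, G.cell j := by
    rintro y ⟨hy, hy'⟩
    obtain ⟨j, hj⟩ := Set.mem_iUnion.1 (interior_subset hy)
    by_cases hjl : j ∈ G.layer i m
    · exact Set.mem_biUnion hjl hj
    · exact absurd (Set.mem_biUnion (show j ∈ (G.layer i m)ᶜ from hjl) hj) hy'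
  refine interior_maximal h1 (isOpen_interior.inter (G.isClosed_biUnion_cell _).isOpen_compl)
    ⟨hx.1, fun h2 => ?_⟩
  obtain ⟨j, hj, hxj⟩ := Set.mem_iUnion₂.1 h2
  exact h j hj hxj

/-- The maximal number of vertices of an element. -/
def maxVerts : ℕ := Finset.univ.sup fun i => (G.verts i).card

lemma card_verts_le (i : ι) : (G.verts i).card ≤ G.maxVerts :=
  Finset.le_sup (f := fun i => (G.verts i).card) (Finset.mem_univ i)

end Fintype

/-- With at most one vertex the cell would be a point or empty and have no interior. The bound
yields `1 + N ≤ N²` for the maximal vertex number `N`, which is how `C_𝒯` absorbs the product-rule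
constant. -/
lemma two_le_card_verts (hd : d ≠ 0) (i : ι) : 2 ≤ (G.verts i).card := by
  by_contra! h
  have : Nonempty (Fin d) := ⟨⟨0, Nat.pos_of_ne_zero hd⟩⟩
  have hs : (G.cell i).Subsingleton := by
    have h1 : (G.vertex '' (G.verts i : Set ν)).Subsingleton :=
      Set.Subsingleton.image (by
        intro a ha b hb
        exact Finset.card_le_one.1 (by omega) a ha b hb) _
    rcases h1.eq_empty_or_singleton with h2 | ⟨y, h2⟩
    · simp [CoarseGrid.cell, h2]
    · simp [CoarseGrid.cell, h2]
  have h3 := G.interior_nonempty i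
  obtain ⟨x, hx⟩ := h3
  have h4 : interior (G.cell i) ⊆ {x} := fun y hy => hs (interior_subset hy) (interior_subset hx)
  have h5 : interior (G.cell i) = {x} := h4.antisymm (Set.singleton_subset_iff.2 hx)
  exact not_isOpen_singleton x (h5 ▸ isOpen_interior)

/-! ### The weight `κ̃` -/

section Weight

lemma kappa_nonneg (x : Space d) : 0 ≤ G.kappa x := Finset.sum_nonneg fun _ _ => sq_nonneg _

lemma measurable_kappa : Measurable G.kappa :=
  Finset.measurable_sum _ fun j _ => ((measurable_gradient (G.chi j)).norm.pow_const 2)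

lemma norm_gradient_chi_le (j : ν) : ∃ C : ℝ, ∀ x ∈ interior G.region,
    ‖gradient (G.chi j) x‖ ≤ C := by
  obtain ⟨C, hC⟩ := G.chi_lipschitz j
  refine ⟨C, fun x hx => ?_⟩
  rw [norm_gradient]
  exact norm_fderiv_le_of_lipschitzOn ℝ (mem_interior_iff_mem_nhds.1 hx) hC

lemma kappa_le : ∃ M : ℝ, 0 ≤ M ∧ ∀ x ∈ interior G.region, G.kappa x ≤ M := by
  choose C hC using G.norm_gradient_chi_le
  refine ⟨∑ j, C j ^ 2, Finset.sum_nonneg fun _ _ => sq_nonneg _, fun x hx =>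
    Finset.sum_le_sum fun j _ => ?_⟩
  exact pow_le_pow_left₀ (norm_nonneg _) (hC j x hx) 2

lemma ae_differentiableAt_chi (i : ι) :
    ∀ᵐ x ∂(volume.restrict (G.elem i)), ∀ j, DifferentiableAt ℝ (G.chi j) x := by
  rw [ae_restrict_iff' (G.isOpen_elem i).measurableSet]
  have : ∀ j, ∀ᵐ x, x ∈ G.region → DifferentiableWithinAt ℝ (G.chi j) G.region x := fun j => by
    obtain ⟨C, hC⟩ := G.chi_lipschitz j
    exact hC.ae_differentiableWithinAt_of_mem
  filter_upwards [ae_all_iff.2 this] with x hx hxe j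
  have hn : G.region ∈ 𝓝 x := mem_of_superset
    (mem_interior_iff_mem_nhds.1 (G.elem_subset_interior i hxe)) (G.cell_subset_region i)
  exact (hx j (mem_of_mem_nhds hn)).differentiableAt hn

lemma gradient_chi_eq_zero {i : ι} {j : ν} (hj : j ∉ G.verts i) {x : Space d}
    (hx : x ∈ interior (G.cell i)) : gradient (G.chi j) x = 0 := by
  have : G.chi j =ᶠ[𝓝 x] fun _ => 0 := by
    filter_upwards [mem_interior_iff_mem_nhds.1 hx] with y hy using G.chi_support i j hj y hy
  rw [this.gradient_eq, gradient_fun_const]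

lemma sum_norm_gradient_chi_sq_le (s : Finset ν) (x : Space d) :
    ∑ j ∈ s, ‖gradient (G.chi j) x‖ ^ 2 ≤ G.kappa x :=
  Finset.sum_le_sum_of_subset_of_nonneg (Finset.subset_univ s) fun _ _ _ => sq_nonneg _

lemma sq_sum_norm_gradient_chi_le (s : Finset ν) (x : Space d) :
    (∑ j ∈ s, ‖gradient (G.chi j) x‖) ^ 2 ≤ s.card * G.kappa x :=
  (sq_sum_le_card_mul_sum_sq).trans
    (mul_le_mul_of_nonneg_left (G.sum_norm_gradient_chi_sq_le s x) (Nat.cast_nonneg _))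

end Weight

/-! ### Cutoffs and bubbles, with gradients controlled by `κ̃` -/

section Cutoff

/-- The partial sum is Lipschitz only on the grid, so it is extended and clamped to `[0, 1]`. On one
element only the gradients at its own vertices survive, and Cauchy–Schwarz over them gives the
vertex number of that element as the factor. -/
lemma exists_lipschitz_partial_sum [Fintype ι] (s : Finset ν) :
    ∃ (ξ : Space d → ℝ) (C : NNReal), LipschitzWith C ξ ∧ (∀ x, 0 ≤ ξ x) ∧ (∀ x, ξ x ≤ 1) ∧
      (∀ x ∈ G.region, ξ x = 1 - ∑ j ∈ s, G.chi j x) ∧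
      ∀ i, ∀ᵐ x ∂(volume.restrict (G.elem i)),
        ‖gradient ξ x‖ ^ 2 ≤ (G.verts i).card * G.kappa x := by
  classical
  choose C hC using G.chi_lipschitz
  have h1 : LipschitzOnWith (∑ j ∈ s, C j) (fun x => 1 - ∑ j ∈ s, G.chi j x) G.region := by
    refine LipschitzOnWith.of_dist_le_mul fun x hx y hy => ?_
    rw [Real.dist_eq, sub_sub_sub_cancel_left, ← Finset.sum_sub_distrib]
    refine (Finset.abs_sum_le_sum_abs _ _).trans ?_
    push_cast
    rw [Finset.sum_mul]
    refine Finset.sum_le_sum fun j _ => ?_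
    rw [abs_sub_comm]
    exact (hC j).dist_le_mul x hx y hy
  obtain ⟨f, hf, hfe⟩ := h1.extend_real
  have hn : ∀ x ∈ G.region, 0 ≤ ∑ j ∈ s, G.chi j x := fun x hx =>
    Finset.sum_nonneg fun j _ => G.chi_nonneg j x hx
  have hle : ∀ x ∈ G.region, ∑ j ∈ s, G.chi j x ≤ 1 := fun x hx => by
    rw [← G.chi_sum x hx]
    exact Finset.sum_le_sum_of_subset_of_nonneg (Finset.subset_univ s)
      fun j _ _ => G.chi_nonneg j x hx
  have heq : ∀ x ∈ G.region, max 0 (min (f x) 1) = 1 - ∑ j ∈ s, G.chi j x := fun x hx => by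
    rw [← hfe hx, min_eq_left (by linarith [hn x hx] : 1 - ∑ j ∈ s, G.chi j x ≤ 1),
      max_eq_right (by linarith [hle x hx])]
  refine ⟨fun x => max 0 (min (f x) 1), _, (hf.min_const 1).const_max 0, fun x => le_max_left _ _,
    fun x => max_le zero_le_one (min_le_right _ _), heq, fun i => ?_⟩
  filter_upwards [G.ae_differentiableAt_chi i,
    ae_restrict_mem (G.isOpen_elem i).measurableSet] with x hx hxe
  have hxi := G.elem_subset_interior i hxe
  have he : (fun x => max 0 (min (f x) 1)) =ᶠ[𝓝 x] fun x => 1 - ∑ j ∈ s, G.chi j x := by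
    filter_upwards [mem_interior_iff_mem_nhds.1 hxi] with y hy
    exact heq y (G.cell_subset_region i hy)
  have hfd : fderiv ℝ (fun x => max 0 (min (f x) 1)) x = - ∑ j ∈ s, fderiv ℝ (G.chi j) x := by
    rw [he.fderiv_eq, fderiv_const_sub, fderiv_fun_sum fun j _ => hx j]
  rw [norm_gradient, hfd, norm_neg]
  have h2 : ∑ j ∈ s, fderiv ℝ (G.chi j) x = ∑ j ∈ s ∩ G.verts i, fderiv ℝ (G.chi j) x := by
    rw [← Finset.sum_inter_add_sum_sdiff s (G.verts i)]
    rw [add_eq_left]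
    refine Finset.sum_eq_zero fun j hj => ?_
    rw [← norm_eq_zero, ← norm_gradient, G.gradient_chi_eq_zero (Finset.mem_sdiff.1 hj).2 hxi,
      norm_zero]
  rw [h2]
  calc ‖∑ j ∈ s ∩ G.verts i, fderiv ℝ (G.chi j) x‖ ^ 2
      ≤ (∑ j ∈ s ∩ G.verts i, ‖gradient (G.chi j) x‖) ^ 2 := by
        refine pow_le_pow_left₀ (norm_nonneg _) ?_ 2
        simp_rw [norm_gradient]
        exact norm_sum_le _ _
    _ ≤ (s ∩ G.verts i).card * G.kappa x := G.sq_sum_norm_gradient_chi_le _ x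
    _ ≤ (G.verts i).card * G.kappa x := by
        refine mul_le_mul_of_nonneg_right ?_ (G.kappa_nonneg x)
        exact_mod_cast Finset.card_le_card Finset.inter_subset_right

/-- A cutoff that vanishes on `m` layers around an element and equals one off `m + 1` layers. -/
lemma exists_cutoff [Fintype ι] (i : ι) (m : ℕ) :
    ∃ (ξ : Space d → ℝ) (C : NNReal), LipschitzWith C ξ ∧ (∀ x, 0 ≤ ξ x) ∧ (∀ x, ξ x ≤ 1) ∧
      (∀ j ∈ G.layer i m, ∀ x ∈ G.cell j, ξ x = 0) ∧
      (∀ j ∉ G.layer i (m + 1), ∀ x ∈ G.cell j, ξ x = 1) ∧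
      ∀ j, ∀ᵐ x ∂(volume.restrict (G.elem j)),
        ‖gradient ξ x‖ ^ 2 ≤ (G.verts j).card * G.kappa x := by
  classical
  -- The sum runs over all vertices of the `m` layers. On a layer cell it contains every nonzero
  -- `χ_v`; a cell touching none of these vertices sees none of it, and a cell that has one of them
  -- belongs to layer `m + 1`.
  obtain ⟨ξ, C, h1, h2, h3, h4, h5⟩ := G.exists_lipschitz_partial_sum
    (Finset.univ.filter fun v => ∃ j ∈ G.layer i m, v ∈ G.verts j)
  refine ⟨ξ, C, h1, h2, h3, fun j hj x hx => ?_, fun j hj x hx => ?_, h5⟩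
  · have hxr := G.cell_subset_region j hx
    rw [h4 x hxr, ← G.chi_sum x hxr, sub_eq_zero]
    refine (Finset.sum_subset (Finset.subset_univ _) fun v _ hv => ?_).symm
    refine G.chi_support j v (fun hvj => hv ?_) x hx
    simp only [Finset.mem_filter, Finset.mem_univ, true_and]
    exact ⟨j, hj, hvj⟩
  · rw [h4 x (G.cell_subset_region j hx), sub_eq_self]
    refine Finset.sum_eq_zero fun v hv => G.chi_support j v (fun hvj => hj ?_) x hx
    simp only [Finset.mem_filter, Finset.mem_univ, true_and] at hv
    obtain ⟨j', hj', hvj'⟩ := hv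
    exact ⟨j', hj', G.vertex v, G.vertex_mem_cell hvj, G.vertex_mem_cell hvj'⟩

lemma bubble_nonneg {i : ι} {x : Space d} (hx : x ∈ G.cell i) : 0 ≤ G.bubble i x :=
  Finset.prod_nonneg fun j _ => G.chi_nonneg j x (G.cell_subset_region i hx)

lemma bubble_le_one {i : ι} {x : Space d} (hx : x ∈ G.cell i) : G.bubble i x ≤ 1 :=
  Finset.prod_le_one (fun j _ => G.chi_nonneg j x (G.cell_subset_region i hx))
    fun j _ => G.chi_le_one j x (G.cell_subset_region i hx)

lemma lipschitzOnWith_prod_chi (s : Finset ν) :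
    ∃ C, LipschitzOnWith C (fun x => ∏ j ∈ s, G.chi j x) G.region := by
  classical
  induction s using Finset.induction_on with
  | empty => exact ⟨0, by simp⟩
  | insert a s ha ih =>
    obtain ⟨C, hC⟩ := ih
    obtain ⟨D, hD⟩ := G.chi_lipschitz a
    refine ⟨D + C, LipschitzOnWith.of_dist_le_mul fun x hx y hy => ?_⟩
    have h1 := hC.dist_le_mul x hx y hy
    have h2 := hD.dist_le_mul x hx y hy
    simp only [Finset.prod_insert ha]
    rw [Real.dist_eq] at h1 h2 ⊢
    have e : G.chi a x * ∏ j ∈ s, G.chi j x - G.chi a y * ∏ j ∈ s, G.chi j y =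
      (G.chi a x - G.chi a y) * ∏ j ∈ s, G.chi j x +
        G.chi a y * (∏ j ∈ s, G.chi j x - ∏ j ∈ s, G.chi j y) := by ring
    rw [e]
    refine (abs_add_le _ _).trans ?_
    rw [abs_mul, abs_mul, abs_of_nonneg (G.chi_nonneg a y hy),
      abs_of_nonneg (Finset.prod_nonneg fun j _ => G.chi_nonneg j x hx)]
    have h3 := mul_le_of_le_one_right (abs_nonneg (G.chi a x - G.chi a y))
      (Finset.prod_le_one (s := s) (fun j _ => G.chi_nonneg j x hx) fun j _ => G.chi_le_one j x hx)
    have h4 := mul_le_of_le_one_left (abs_nonneg (∏ j ∈ s, G.chi j x - ∏ j ∈ s, G.chi j y))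
      (G.chi_le_one a y hy)
    push_cast
    linarith

/-- A segment leaving `s` crosses the frontier, where `f` vanishes; comparing with the crossing
point keeps the same constant. -/
lemma lipschitzWith_indicator {s : Set (Space d)} {f : Space d → ℝ} {C : NNReal}
    (hf : LipschitzOnWith C f s) (hs : IsClosed s) (hz : ∀ x ∈ frontier s, f x = 0) :
    LipschitzWith C (s.indicator f) := by
  have key : ∀ x ∈ s, ∀ y ∉ s, |f x| ≤ C * dist x y := by
    intro x hx y hy
    obtain ⟨z, hz1, hz2⟩ : ∃ z ∈ segment ℝ x y, z ∈ frontier s := by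
      by_contra! h
      have hxi : x ∈ interior s := by
        by_contra hxi
        exact h x (left_mem_segment ℝ x y) ⟨subset_closure hx, hxi⟩
      have hcov : segment ℝ x y ⊆ interior s ∪ sᶜ := fun w hw => by
        by_cases hws : w ∈ s
        · left
          by_contra hwi
          exact h w hw ⟨subset_closure hws, hwi⟩
        · exact Or.inr hws
      obtain ⟨w, -, hw1, hw2⟩ := (convex_segment (𝕜 := ℝ) x y).isPreconnected (interior s) sᶜ
        isOpen_interior hs.isOpen_compl hcov ⟨x, left_mem_segment ℝ x y, hxi⟩
        ⟨y, right_mem_segment ℝ x y, hy⟩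
      exact hw2 (interior_subset hw1)
    have h1 := hf.dist_le_mul x hx z (hs.frontier_subset hz2)
    rw [Real.dist_eq, hz z hz2, sub_zero] at h1
    have h2 := dist_add_dist_of_mem_segment hz1
    refine h1.trans (mul_le_mul_of_nonneg_left ?_ C.2)
    linarith [dist_nonneg (x := z) (y := y)]
  refine LipschitzWith.of_dist_le_mul fun x y => ?_
  rw [Real.dist_eq]
  by_cases hx : x ∈ s <;> by_cases hy : y ∈ s
  · rw [Set.indicator_of_mem hx, Set.indicator_of_mem hy]
    exact hf.dist_le_mul x hx y hy
  · rw [Set.indicator_of_mem hx, Set.indicator_of_notMem hy, sub_zero]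
    exact key x hx y hy
  · rw [Set.indicator_of_notMem hx, Set.indicator_of_mem hy, zero_sub, abs_neg, dist_comm]
    exact key y hy x hx
  · rw [Set.indicator_of_notMem hx, Set.indicator_of_notMem hy, sub_zero, abs_zero]
    positivity

/-- In the product rule the undifferentiated factors are at most one, so the gradient is bounded by
the sum of the `‖∇χ_j‖`, and Cauchy–Schwarz applies. -/
lemma norm_gradient_bubble_sq_le (i : ι) : ∀ᵐ x ∂(volume.restrict (G.elem i)),
    ‖gradient (G.bubble i) x‖ ^ 2 ≤ (G.verts i).card * G.kappa x := by
  classical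
  filter_upwards [G.ae_differentiableAt_chi i,
    ae_restrict_mem (G.isOpen_elem i).measurableSet] with x hx hxe
  have hxr := G.cell_subset_region i (G.elem_subset_cell i hxe)
  refine le_trans (pow_le_pow_left₀ (norm_nonneg _) ?_ 2)
    (G.sq_sum_norm_gradient_chi_le (G.verts i) x)
  rw [norm_gradient]
  have h1 : HasFDerivAt (G.bubble i) _ x :=
    HasFDerivAt.finsetProd (u := G.verts i) fun j _ => (hx j).hasFDerivAt
  rw [h1.fderiv]
  refine (norm_sum_le _ _).trans (Finset.sum_le_sum fun j _ => ?_)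
  rw [norm_smul, norm_gradient, Real.norm_of_nonneg
    (Finset.prod_nonneg fun j _ => G.chi_nonneg j x hxr)]
  exact mul_le_of_le_one_left (norm_nonneg _)
    (Finset.prod_le_one (fun j _ => G.chi_nonneg j x hxr) fun j _ => G.chi_le_one j x hxr)

/-- The bubble function of an element, extended by zero. -/
def bubbleExt (i : ι) : Space d → ℝ := (G.cell i).indicator (G.bubble i)

lemma exists_lipschitzWith_bubbleExt (i : ι) : ∃ C, LipschitzWith C (G.bubbleExt i) := by
  obtain ⟨C, hC⟩ := G.lipschitzOnWith_prod_chi (G.verts i)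
  exact ⟨C, lipschitzWith_indicator (hC.mono (G.cell_subset_region i)) (G.isClosed_cell i)
    (G.bubble_zero i)⟩

lemma bubbleExt_nonneg (i : ι) (x : Space d) : 0 ≤ G.bubbleExt i x :=
  Set.indicator_nonneg (fun _ hx => G.bubble_nonneg hx) x

lemma bubbleExt_le_one (i : ι) (x : Space d) : G.bubbleExt i x ≤ 1 :=
  Set.indicator_le' (fun _ hx => G.bubble_le_one hx) (fun _ _ => zero_le_one) x

lemma bubbleExt_eq {i : ι} {x : Space d} (hx : x ∈ G.elem i) : G.bubbleExt i x = G.bubble i x :=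
  Set.indicator_of_mem (G.elem_subset_cell i hx) _

/-- This is the vanishing condition needed in `IsH1.mul_lipschitz`: nothing is required on the
perforations, so a bubble times a function in `H¹(K_i)` extends by zero to the complement of the
holes. -/
lemma bubbleExt_eq_zero {i : ι} {x : Space d} (hx : x ∉ G.holes) (hxe : x ∉ G.elem i) :
    G.bubbleExt i x = 0 := by
  by_cases h : x ∈ G.cell i
  · rw [bubbleExt, Set.indicator_of_mem h]
    exact G.bubble_zero i x ⟨subset_closure h, fun h' => hxe ⟨h', hx⟩⟩
  · exact Set.indicator_of_notMem h _

lemma gradient_bubbleExt {i : ι} {x : Space d} (hx : x ∈ G.elem i) :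
    gradient (G.bubbleExt i) x = gradient (G.bubble i) x := by
  refine Filter.EventuallyEq.gradient_eq ?_
  filter_upwards [(G.isOpen_elem i).mem_nhds hx] with y hy using G.bubbleExt_eq hy

end Cutoff

end PerforatedGrid

/-! ### The energy and weighted forms as bilinear forms on `H¹` -/

section Forms

variable {d : ℕ} {U : Set (Space d)} {u v : Space d → ℝ} {g g' : Space d → Space d}

lemma integrable_inner_of_memLp {μ : Measure (Space d)} (hg : MemLp g 2 μ) (hg' : MemLp g' 2 μ) :
    Integrable (fun x => (inner ℝ (g x) (g' x) : ℝ)) μ := by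
  refine (hg.norm.integrable_mul hg'.norm).mono' (hg.1.inner hg'.1)
    (Eventually.of_forall fun x => ?_)
  exact norm_inner_le_norm _ _

lemma integrable_norm_sq_of_memLp {μ : Measure (Space d)} (hg : MemLp g 2 μ) :
    Integrable (fun x => ‖g x‖ ^ 2) μ := hg.integrable_norm_pow (by norm_num)

lemma integrable_weight_mul {w : Space d → ℝ} (hU : MeasurableSet U) (hw : Measurable w)
    (hb : ∃ M, ∀ x ∈ U, |w x| ≤ M) (hu : MemLp u 2 (volume.restrict U))
    (hv : MemLp v 2 (volume.restrict U)) :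
    Integrable (fun x => w x * u x * v x) (volume.restrict U) := by
  obtain ⟨M, hM⟩ := hb
  simp_rw [mul_assoc]
  exact Integrable.bdd_mul (c := M) (hu.integrable_mul hv) hw.aestronglyMeasurable
    (ae_restrict_of_forall_mem hU hM)

/-- The space `H¹(U)`. -/
def h1Space (U : Set (Space d)) : Submodule ℝ (Space d → ℝ) where
  carrier := {v | MemH1 U v}
  add_mem' ha hb := by
    obtain ⟨g, hg⟩ := MemH1.exists_isH1 ha
    obtain ⟨g', hg'⟩ := MemH1.exists_isH1 hb
    exact (hg.add hg').memH1
  zero_mem' := IsH1.zero.memH1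
  smul_mem' c a ha := by
    obtain ⟨g, hg⟩ := MemH1.exists_isH1 ha
    exact (hg.smul c).memH1

lemma MemH1.isH1_weakGrad (h : MemH1 U u) : IsH1 U u (weakGrad U u) := by
  refine ⟨h.1, ?_⟩
  unfold weakGrad
  rw [dif_pos h.2]
  exact h.2.choose_spec

lemma MemH1.isH1_of_mem (u : h1Space U) : IsH1 U u.1 (weakGrad U u.1) := MemH1.isH1_weakGrad u.2

lemma energy_comm : energy U u v = energy U v u := by
  unfold energy
  simp_rw [real_inner_comm]

lemma energy_nonneg : 0 ≤ energy U u u := integral_nonneg fun _ => real_inner_self_nonneg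

/-- The energy form on `H¹(U)`. -/
def energyForm (hU : IsOpen U) : LinearMap.BilinForm ℝ (h1Space U) :=
  LinearMap.mk₂ ℝ (fun u v => energy U u.1 v.1)
    (fun u u' v => by
      have h := MemH1.isH1_of_mem u
      have h' := MemH1.isH1_of_mem u'
      have h2 := MemH1.isH1_of_mem v
      rw [Submodule.coe_add, energy_eq hU (h.add h') h2, energy_eq hU h h2, energy_eq hU h' h2,
        ← integral_add (integrable_inner_of_memLp h.2.1 h2.2.1)
          (integrable_inner_of_memLp h'.2.1 h2.2.1)]
      simp only [Pi.add_apply, inner_add_left])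
    (fun c u v => by
      have h := MemH1.isH1_of_mem u
      have h2 := MemH1.isH1_of_mem v
      rw [Submodule.coe_smul, energy_eq hU (h.smul c) h2, energy_eq hU h h2, smul_eq_mul,
        ← integral_const_mul]
      simp only [Pi.smul_apply, real_inner_smul_left])
    (fun v u u' => by
      have h := MemH1.isH1_of_mem u
      have h' := MemH1.isH1_of_mem u'
      have h2 := MemH1.isH1_of_mem v
      rw [Submodule.coe_add, energy_eq hU h2 (h.add h'), energy_eq hU h2 h, energy_eq hU h2 h',
        ← integral_add (integrable_inner_of_memLp h2.2.1 h.2.1)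
          (integrable_inner_of_memLp h2.2.1 h'.2.1)]
      simp only [Pi.add_apply, inner_add_right])
    (fun c u v => by
      have h := MemH1.isH1_of_mem u
      have h2 := MemH1.isH1_of_mem v
      rw [Submodule.coe_smul, energy_eq hU h (h2.smul c), energy_eq hU h h2, smul_eq_mul,
        ← integral_const_mul]
      simp only [Pi.smul_apply, real_inner_smul_right])

/-- The weighted `L²` form on `H¹(U)`. -/
def weightForm (hU : IsOpen U) (w : Space d → ℝ) (hw : Measurable w)
    (hb : ∃ M, ∀ x ∈ U, |w x| ≤ M) : LinearMap.BilinForm ℝ (h1Space U) :=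
  LinearMap.mk₂ ℝ (fun u v => ∫ x in U, w x * u.1 x * v.1 x)
    (fun u u' v => by
      rw [← integral_add (integrable_weight_mul hU.measurableSet hw hb u.2.1 v.2.1)
          (integrable_weight_mul hU.measurableSet hw hb u'.2.1 v.2.1)]
      congr 1 with x
      simp only [Submodule.coe_add, Pi.add_apply]
      ring)
    (fun c u v => by
      rw [smul_eq_mul, ← integral_const_mul]
      congr 1 with x
      simp only [Submodule.coe_smul, Pi.smul_apply, smul_eq_mul]
      ring)
    (fun v u u' => by
      rw [← integral_add (integrable_weight_mul hU.measurableSet hw hb v.2.1 u.2.1)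
          (integrable_weight_mul hU.measurableSet hw hb v.2.1 u'.2.1)]
      congr 1 with x
      simp only [Submodule.coe_add, Pi.add_apply]
      ring)
    (fun c u v => by
      rw [smul_eq_mul, ← integral_const_mul]
      congr 1 with x
      simp only [Submodule.coe_smul, Pi.smul_apply, smul_eq_mul]
      ring)

lemma bilinForm_sum_diag {V κ : Type*} [AddCommGroup V] [Module ℝ V] [Fintype κ]
    (B : LinearMap.BilinForm ℝ V) (f : κ → V) (h : ∀ p q, p ≠ q → B (f p) (f q) = 0)
    (c : κ → ℝ) : B (∑ p, c p • f p) (∑ p, c p • f p) = ∑ p, c p ^ 2 * B (f p) (f p) := by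
  classical
  simp only [map_sum, LinearMap.sum_apply, map_smul, LinearMap.smul_apply, smul_eq_mul]
  refine Finset.sum_congr rfl fun p _ => ?_
  rw [Finset.sum_eq_single p (fun q _ hq => by rw [h q p hq]; ring) (by simp)]
  ring

end Forms

namespace PerforatedGrid

variable {d : ℕ} {ι ν : Type*} [Fintype ν] (G : PerforatedGrid d ι ν)

lemma kappa_bounded (i : ι) : ∃ M, ∀ x ∈ G.elem i, |G.kappa x| ≤ M := by
  obtain ⟨M, -, hM⟩ := G.kappa_le
  refine ⟨M, fun x hx => ?_⟩
  rw [abs_of_nonneg (G.kappa_nonneg x)]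
  exact hM x (interior_mono (G.cell_subset_region i) (G.elem_subset_interior i hx))

lemma measurable_bubbleExt (i : ι) : Measurable (G.bubbleExt i) := by
  obtain ⟨C, hC⟩ := G.exists_lipschitzWith_bubbleExt i
  exact hC.continuous.measurable

lemma bubble_kappa_bounded (i : ι) :
    ∃ M, ∀ x ∈ G.elem i, |(G.bubbleExt i * G.kappa) x| ≤ M := by
  obtain ⟨M, hM⟩ := G.kappa_bounded i
  refine ⟨M, fun x hx => ?_⟩
  rw [Pi.mul_apply, abs_mul, abs_of_nonneg (G.bubbleExt_nonneg i x)]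
  exact (mul_le_of_le_one_left (abs_nonneg _) (G.bubbleExt_le_one i x)).trans (hM x hx)

/-- The form `s_i` on `H¹(K_i)`. -/
def sBilin (i : ι) : LinearMap.BilinForm ℝ (h1Space (G.elem i)) :=
  weightForm (G.isOpen_elem i) G.kappa G.measurable_kappa (G.kappa_bounded i)

/-- The form `∫_{K_i} B κ̃ u v` on `H¹(K_i)`. -/
def bBilin (i : ι) : LinearMap.BilinForm ℝ (h1Space (G.elem i)) :=
  weightForm (G.isOpen_elem i) (G.bubbleExt i * G.kappa)
    ((G.measurable_bubbleExt i).mul G.measurable_kappa) (G.bubble_kappa_bounded i)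

/-- The form `a_i` on `H¹(K_i)`. -/
def aBilin (i : ι) : LinearMap.BilinForm ℝ (h1Space (G.elem i)) := energyForm (G.isOpen_elem i)

lemma sBilin_apply (i : ι) (u v : h1Space (G.elem i)) : G.sBilin i u v = G.sLoc i u.1 v.1 := rfl

lemma aBilin_apply (i : ι) (u v : h1Space (G.elem i)) :
    G.aBilin i u v = energy (G.elem i) u.1 v.1 := rfl

lemma bBilin_apply (i : ι) (u v : h1Space (G.elem i)) :
    G.bBilin i u v = G.sLoc i (G.bubbleExt i * u.1) v.1 := by
  change ∫ x in G.elem i, _ = ∫ x in G.elem i, _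
  congr 1 with x
  simp only [Pi.mul_apply]
  ring

lemma bBilin_self (i : ι) (u : h1Space (G.elem i)) :
    G.bBilin i u u = ∫ x in G.elem i, G.bubble i x * G.kappa x * u.1 x ^ 2 := by
  refine setIntegral_congr_fun (G.isOpen_elem i).measurableSet fun x hx => ?_
  simp only [Pi.mul_apply, G.bubbleExt_eq hx]
  ring

lemma sLoc_comm (i : ι) (u v : Space d → ℝ) : G.sLoc i u v = G.sLoc i v u := by
  unfold sLoc
  congr 1 with x
  ring

lemma sLoc_self_nonneg (i : ι) (u : Space d → ℝ) : 0 ≤ G.sLoc i u u :=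
  integral_nonneg fun x => by
    simp only [Pi.zero_apply, mul_assoc]
    exact mul_nonneg (G.kappa_nonneg x) (mul_self_nonneg _)

lemma bBilin_le_sBilin (i : ι) (u : h1Space (G.elem i)) : G.bBilin i u u ≤ G.sBilin i u u := by
  refine integral_mono (integrable_weight_mul (G.isOpen_elem i).measurableSet
    ((G.measurable_bubbleExt i).mul G.measurable_kappa) (G.bubble_kappa_bounded i) u.2.1 u.2.1)
    (integrable_weight_mul (G.isOpen_elem i).measurableSet G.measurable_kappa
      (G.kappa_bounded i) u.2.1 u.2.1) fun x => ?_
  simp only [Pi.mul_apply, mul_assoc]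
  exact mul_le_of_le_one_left (mul_nonneg (G.kappa_nonneg x) (mul_self_nonneg _))
    (G.bubbleExt_le_one i x)

lemma bBilin_self_nonneg (i : ι) (u : h1Space (G.elem i)) : 0 ≤ G.bBilin i u u :=
  integral_nonneg fun x => by
    simp only [Pi.mul_apply, Pi.zero_apply, mul_assoc]
    exact mul_nonneg (G.bubbleExt_nonneg i x)
      (mul_nonneg (G.kappa_nonneg x) (mul_self_nonneg _))

lemma bubble_pos_of_mem {i : ι} {x : Space d} (hx : x ∈ G.elem i) : 0 < G.bubbleExt i x := by
  rw [G.bubbleExt_eq hx]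
  exact G.bubble_pos i x (G.elem_subset_interior i hx)

/-- The bubble is positive inside the element, so a zero bubble integral forces `κ̃ u² = 0` almost
everywhere. Hence the bubble form is definite wherever `s_i` is. -/
lemma sBilin_eq_zero_of_bBilin (i : ι) (u : h1Space (G.elem i)) (h : G.bBilin i u u = 0) :
    G.sBilin i u u = 0 := by
  have h1 : ∫ x in G.elem i, (G.bubbleExt i * G.kappa) x * u.1 x * u.1 x = 0 := h
  rw [integral_eq_zero_iff_of_nonneg (fun x => ?_)
    (integrable_weight_mul (G.isOpen_elem i).measurableSet
      ((G.measurable_bubbleExt i).mul G.measurable_kappa) (G.bubble_kappa_bounded i)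
      u.2.1 u.2.1)] at h1
  · change ∫ x in G.elem i, G.kappa x * u.1 x * u.1 x = 0
    refine integral_eq_zero_of_ae ?_
    filter_upwards [h1, ae_restrict_mem (G.isOpen_elem i).measurableSet] with x hx hxe
    have h2 := (G.bubble_pos_of_mem hxe).ne'
    simp only [Pi.mul_apply, Pi.zero_apply, mul_assoc] at hx ⊢
    exact (mul_eq_zero.1 hx).resolve_left h2
  · simp only [Pi.mul_apply, Pi.zero_apply, mul_assoc]
    exact mul_nonneg (G.bubbleExt_nonneg i x)
      (mul_nonneg (G.kappa_nonneg x) (mul_self_nonneg _))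

/-! ### The min-max eigenvalues -/

section Eigenvalues

/-- The set whose infimum is the `n`-th eigenvalue. -/
def eigenSet (i : ι) (n : ℕ) : Set ℝ :=
  {t : ℝ | ∃ W : Submodule ℝ (Space d → ℝ), Module.finrank ℝ W = n ∧
    (∀ v ∈ W, MemH1 (G.elem i) v) ∧
    (∀ v ∈ W, v ≠ 0 → 0 < G.sLoc i v v) ∧
    ∀ v ∈ W, energy (G.elem i) v v ≤ t * G.sLoc i v v}

lemma eigenvalue_eq (i : ι) (n : ℕ) : G.eigenvalue i n = sInf (G.eigenSet i n) := rfl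

lemma eigenSet_nonneg {i : ι} {n : ℕ} (hn : 1 ≤ n) {t : ℝ} (ht : t ∈ G.eigenSet i n) : 0 ≤ t := by
  obtain ⟨W, hW, -, h2, h3⟩ := ht
  have : Nontrivial W := Module.nontrivial_of_finrank_pos (R := ℝ) (by omega)
  obtain ⟨⟨w, hw⟩, hw0⟩ := exists_ne (0 : W)
  have hw0' : w ≠ 0 := fun h => hw0 (Subtype.ext h)
  have h4 := h2 w hw hw0'
  have h5 := (energy_nonneg (U := G.elem i) (u := w)).trans (h3 w hw)
  exact nonneg_of_mul_nonneg_left h5 h4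

lemma bddBelow_eigenSet {i : ι} {n : ℕ} (hn : 1 ≤ n) : BddBelow (G.eigenSet i n) :=
  ⟨0, fun _ ht => G.eigenSet_nonneg hn ht⟩

lemma eigenvalue_nonneg {i : ι} {n : ℕ} (hn : 1 ≤ n) : 0 ≤ G.eigenvalue i n :=
  Real.sInf_nonneg fun _ ht => G.eigenSet_nonneg hn ht

lemma eigenSet_anti {i : ι} {n m : ℕ} (hnm : n ≤ m) (hm : 1 ≤ m) :
    G.eigenSet i m ⊆ G.eigenSet i n := by
  rintro t ⟨W, hW, h1, h2, h3⟩
  have : Module.Finite ℝ W := Module.finite_of_finrank_pos (by omega)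
  let b := Module.finBasisOfFinrankEq ℝ W hW
  let f : Fin n → Space d → ℝ := fun p => (b (Fin.castLE hnm p) : Space d → ℝ)
  have hli : LinearIndependent ℝ f :=
    (b.linearIndependent.comp _ (Fin.castLE_injective hnm)).map' W.subtype (by simp)
  have hle : Submodule.span ℝ (Set.range f) ≤ W := by
    rw [Submodule.span_le]
    rintro _ ⟨p, rfl⟩
    exact (b _).2
  refine ⟨Submodule.span ℝ (Set.range f), ?_, fun v hv => h1 v (hle hv), fun v hv => h2 v (hle hv),
    fun v hv => h3 v (hle hv)⟩
  rw [finrank_span_eq_card hli, Fintype.card_fin]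

/-- On the span of a family orthogonal for both forms, both are weighted sums of squares of the
coefficients, so the Rayleigh bound can be checked on each member. Positivity of `s_i` also gives
linear independence. -/
lemma mem_eigenSet_of_diag {i : ι} {n : ℕ} {t : ℝ} (f : Fin n → h1Space (G.elem i))
    (hs : ∀ p q, p ≠ q → G.sBilin i (f p) (f q) = 0) (hp : ∀ p, 0 < G.sBilin i (f p) (f p))
    (ha : ∀ p q, p ≠ q → G.aBilin i (f p) (f q) = 0)
    (hat : ∀ p, G.aBilin i (f p) (f p) ≤ t * G.sBilin i (f p) (f p)) :
    t ∈ G.eigenSet i n := by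
  have hpos : ∀ c : Fin n → ℝ, c ≠ 0 →
      0 < G.sBilin i (∑ p, c p • f p) (∑ p, c p • f p) := fun c hc => by
    rw [bilinForm_sum_diag _ f hs]
    obtain ⟨p, hp'⟩ := Function.ne_iff.1 hc
    exact Finset.sum_pos' (fun q _ => mul_nonneg (sq_nonneg _) (hp q).le)
      ⟨p, Finset.mem_univ p, mul_pos (sq_pos_iff.2 hp') (hp p)⟩
  have hli0 : LinearIndependent ℝ f := by
    rw [Fintype.linearIndependent_iff]
    intro c hc p
    by_contra hcp
    have := hpos c (fun h => hcp (by rw [h]; rfl))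
    rw [hc] at this
    simp at this
  let f' : Fin n → Space d → ℝ := fun p => (f p : Space d → ℝ)
  have hli : LinearIndependent ℝ f' := hli0.map' (h1Space (G.elem i)).subtype (by simp)
  have hmem : ∀ v ∈ Submodule.span ℝ (Set.range f'), ∃ c : Fin n → ℝ,
      ((∑ p, c p • f p : h1Space (G.elem i)) : Space d → ℝ) = v := fun v hv => by
    obtain ⟨c, hc⟩ := (Submodule.mem_span_range_iff_exists_fun ℝ).1 hv
    exact ⟨c, by rw [← hc]; simp [f']⟩
  refine ⟨Submodule.span ℝ (Set.range f'), by rw [finrank_span_eq_card hli, Fintype.card_fin],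
    fun v hv => ?_, fun v hv hv0 => ?_, fun v hv => ?_⟩
  · obtain ⟨c, rfl⟩ := hmem v hv
    exact (∑ p, c p • f p : h1Space (G.elem i)).2
  · obtain ⟨c, rfl⟩ := hmem v hv
    refine hpos c fun h => hv0 ?_
    simp [h]
  · obtain ⟨c, rfl⟩ := hmem v hv
    rw [← G.aBilin_apply, ← G.sBilin_apply, bilinForm_sum_diag _ f hs, bilinForm_sum_diag _ f ha,
      Finset.mul_sum]
    refine Finset.sum_le_sum fun p _ => ?_
    have := mul_le_mul_of_nonneg_left (hat p) (sq_nonneg (c p))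
    linarith

end Eigenvalues

end PerforatedGrid

/-! ### Spectral bounds from the auxiliary basis -/

namespace PerforatedGrid

variable {d : ℕ} {ι ν : Type*} [Fintype ν] {G : PerforatedGrid d ι ν}
  {l : ι → ℕ} {φ : (i : ι) → Fin (l i) → Space d → ℝ}

/-- The eigenfunctions as elements of `H¹(K_i)`. -/
def IsAuxBasis.fn (hφ : G.IsAuxBasis l φ) (i : ι) (j : Fin (l i)) : h1Space (G.elem i) :=
  ⟨φ i j, hφ.memH1 i j⟩

lemma IsAuxBasis.sBilin_fn (hφ : G.IsAuxBasis l φ) (i : ι) (j j' : Fin (l i)) :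
    G.sBilin i (hφ.fn i j) (hφ.fn i j') = if j = j' then 1 else 0 := hφ.orthonormal i j j'

lemma IsAuxBasis.aBilin_fn (hφ : G.IsAuxBasis l φ) (i : ι) (j : Fin (l i))
    (v : h1Space (G.elem i)) :
    G.aBilin i (hφ.fn i j) v = G.eigenvalue i (j + 1) * G.sBilin i (hφ.fn i j) v :=
  hφ.eigen i j v.1 v.2

lemma IsAuxBasis.elem_nonempty (hφ : G.IsAuxBasis l φ) (i : ι) : (G.elem i).Nonempty := by
  by_contra h
  have h1 := hφ.orthonormal i ⟨0, hφ.one_le i⟩ ⟨0, hφ.one_le i⟩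
  rw [Set.not_nonempty_iff_eq_empty] at h
  simp [sLoc, h] at h1

lemma aBilin_comm (i : ι) (u v : h1Space (G.elem i)) : G.aBilin i u v = G.aBilin i v u :=
  energy_comm

lemma sBilin_comm (i : ι) (u v : h1Space (G.elem i)) : G.sBilin i u v = G.sBilin i v u :=
  G.sLoc_comm i _ _

lemma sBilin_self_nonneg (i : ι) (u : h1Space (G.elem i)) : 0 ≤ G.sBilin i u u :=
  G.sLoc_self_nonneg i _

/-- Needed for monotonicity of the eigenvalues: the infimum of an empty set would be the default
value `0`. -/
lemma IsAuxBasis.eigenSet_nonempty (hφ : G.IsAuxBasis l φ) (i : ι) :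
    (G.eigenSet i (l i)).Nonempty := by
  -- Any number above all the eigenvalues would do; the sum is one because they are nonnegative.
  refine ⟨∑ j : Fin (l i), G.eigenvalue i (j + 1), G.mem_eigenSet_of_diag (hφ.fn i)
    (fun p q h => by rw [hφ.sBilin_fn, if_neg h]) (fun p => by rw [hφ.sBilin_fn, if_pos rfl]; simp)
    (fun p q h => by rw [hφ.aBilin_fn, hφ.sBilin_fn, if_neg h, mul_zero]) fun p => ?_⟩
  rw [hφ.aBilin_fn, hφ.sBilin_fn, if_pos rfl, mul_one, mul_one]
  exact Finset.single_le_sum (f := fun j : Fin (l i) => G.eigenvalue i (j + 1))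
    (fun j _ => G.eigenvalue_nonneg (by omega)) (Finset.mem_univ p)

lemma IsAuxBasis.eigenvalue_le (hφ : G.IsAuxBasis l φ) (i : ι) (j : Fin (l i)) :
    G.eigenvalue i (j + 1) ≤ G.eigenvalue i (l i) := by
  rw [eigenvalue_eq, eigenvalue_eq]
  exact csInf_le_csInf (G.bddBelow_eigenSet (by omega)) (hφ.eigenSet_nonempty i)
    (G.eigenSet_anti (by omega) (hφ.one_le i))

/-- If the Rayleigh quotient `R` of `u` were below `λ_{l_i+1}`, adjoining `u` to suitably many
eigenfunctions would give a trial space contradicting min-max. -/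
lemma IsAuxBasis.eigenvalue_mul_le (hφ : G.IsAuxBasis l φ) (i : ι) (u : h1Space (G.elem i))
    (hu : ∀ j, G.sBilin i u (hφ.fn i j) = 0) :
    G.eigenvalue i (l i + 1) * G.sBilin i u u ≤ G.aBilin i u u := by
  rcases (sBilin_self_nonneg i u).eq_or_lt with h0 | h0
  · rw [← h0, mul_zero]
    exact energy_nonneg
  by_contra! hlt
  set R := G.aBilin i u u / G.sBilin i u u with hR
  have hRl : R < G.eigenvalue i (l i + 1) := by rwa [hR, div_lt_iff₀ h0]
  -- `R` may lie below earlier eigenvalues too. For the least such `n`, the first `n` eigenvalues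
  -- are at most `R`, so these eigenfunctions and `u` span an `(n + 1)`-dimensional space with
  -- quotient at most `R`.
  have hex : ∃ n, R < G.eigenvalue i (n + 1) := ⟨l i, hRl⟩
  classical
  set n := Nat.find hex with hn
  have hn1 : R < G.eigenvalue i (n + 1) := Nat.find_spec hex
  have hnl : n ≤ l i := Nat.find_min' hex hRl
  have hmin : ∀ p : Fin n, G.eigenvalue i (p + 1) ≤ R := fun p =>
    not_lt.1 (Nat.find_min hex p.2)
  let f : Fin (n + 1) → h1Space (G.elem i) :=
    Fin.snoc (α := fun _ => h1Space (G.elem i)) (fun p : Fin n => hφ.fn i (Fin.castLE hnl p)) u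
  have fc : ∀ p : Fin n, f p.castSucc = hφ.fn i (Fin.castLE hnl p) := fun p => by simp [f]
  have fl : f (Fin.last n) = u := by simp [f]
  have hu' : ∀ j, G.sBilin i (hφ.fn i j) u = 0 := fun j => by rw [sBilin_comm, hu]
  have hs : ∀ p q, p ≠ q → G.sBilin i (f p) (f q) = 0 := by
    intro p q
    refine Fin.lastCases ?_ (fun p => ?_) p <;> refine Fin.lastCases ?_ (fun q => ?_) q
    · intro h; exact absurd rfl h
    · intro _; rw [fl, fc, hu]
    · intro _; rw [fl, fc, hu']
    · intro h
      rw [fc, fc, hφ.sBilin_fn, if_neg]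
      intro h'
      exact h (by rw [Fin.castLE_injective hnl h'])
  have key : R ∈ G.eigenSet i (n + 1) := by
    refine G.mem_eigenSet_of_diag f hs (fun p => ?_) (fun p q hpq => ?_) fun p => ?_
    · refine Fin.lastCases ?_ (fun p => ?_) p
      · rwa [fl]
      · rw [fc, hφ.sBilin_fn, if_pos rfl]; exact one_pos
    · have hpq' := hs p q hpq
      revert hpq hpq'
      refine Fin.lastCases ?_ (fun p => ?_) p
      · refine Fin.lastCases ?_ (fun q => ?_) q
        · intro h; exact absurd rfl h
        · intro _ h
          rw [fl, fc] at h ⊢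
          rw [aBilin_comm, hφ.aBilin_fn, hu', mul_zero]
      · intro _ h
        rw [fc] at h ⊢
        rw [hφ.aBilin_fn, h, mul_zero]
    · refine Fin.lastCases ?_ (fun p => ?_) p
      · rw [fl, hR, div_mul_cancel₀ _ h0.ne']
      · rw [fc, hφ.aBilin_fn, hφ.sBilin_fn, if_pos rfl, mul_one, mul_one]
        exact hmin p
  exact absurd (csInf_le (G.bddBelow_eigenSet (by omega)) key) (not_le.2 hn1)

/-! ### The bubble-weighted projection and `C_π` -/

section Projection

lemma IsAuxBasis.sBilin_sum (hφ : G.IsAuxBasis l φ) (i : ι) (c : Fin (l i) → ℝ) :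
    G.sBilin i (∑ p, c p • hφ.fn i p) (∑ p, c p • hφ.fn i p) = ∑ p, c p ^ 2 := by
  rw [bilinForm_sum_diag _ _ fun p q h => by rw [hφ.sBilin_fn, if_neg h]]
  simp [hφ.sBilin_fn]

lemma IsAuxBasis.aBilin_sum_le (hφ : G.IsAuxBasis l φ) (i : ι) (c : Fin (l i) → ℝ) :
    G.aBilin i (∑ p, c p • hφ.fn i p) (∑ p, c p • hφ.fn i p) ≤
      G.eigenvalue i (l i) * G.sBilin i (∑ p, c p • hφ.fn i p) (∑ p, c p • hφ.fn i p) := by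
  rw [hφ.sBilin_sum, bilinForm_sum_diag _ _ fun p q h => by
    rw [hφ.aBilin_fn, hφ.sBilin_fn, if_neg h, mul_zero], Finset.mul_sum]
  refine Finset.sum_le_sum fun p _ => ?_
  rw [hφ.aBilin_fn, hφ.sBilin_fn, if_pos rfl, mul_one, mul_comm]
  exact mul_le_mul_of_nonneg_right (hφ.eigenvalue_le i p) (sq_nonneg _)

/-- The bubble form is continuous and positive on the compact unit sphere of coefficients, hence
bounded below there; homogeneity does the rest. -/
lemma IsAuxBasis.exists_sBilin_le (hφ : G.IsAuxBasis l φ) (i : ι) :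
    ∃ M : ℝ, ∀ c : Fin (l i) → ℝ,
      G.sBilin i (∑ p, c p • hφ.fn i p) (∑ p, c p • hφ.fn i p) ≤
        M * G.bBilin i (∑ p, c p • hφ.fn i p) (∑ p, c p • hφ.fn i p) := by
  have hne : Nonempty (Fin (l i)) := ⟨⟨0, hφ.one_le i⟩⟩
  let q : EuclideanSpace ℝ (Fin (l i)) → ℝ := fun c =>
    G.bBilin i (∑ p, c p • hφ.fn i p) (∑ p, c p • hφ.fn i p)
  have hq : Continuous q := by
    have : q = fun c => ∑ p, c p * ∑ p', c p' * G.bBilin i (hφ.fn i p') (hφ.fn i p) := by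
      ext c
      simp only [q, map_sum, LinearMap.sum_apply, map_smul, LinearMap.smul_apply, smul_eq_mul]
    rw [this]
    fun_prop
  obtain ⟨c₀, hc₀, hmin⟩ := (isCompact_sphere (0 : EuclideanSpace ℝ (Fin (l i))) 1).exists_isMinOn
    (NormedSpace.sphere_nonempty.2 zero_le_one) hq.continuousOn
  have hnorm : ∀ c : EuclideanSpace ℝ (Fin (l i)),
      G.sBilin i (∑ p, c p • hφ.fn i p) (∑ p, c p • hφ.fn i p) = ‖c‖ ^ 2 := fun c => by
    rw [hφ.sBilin_sum, EuclideanSpace.norm_sq_eq]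
    simp
  have hpos : 0 < q c₀ := by
    refine lt_of_le_of_ne (G.bBilin_self_nonneg i _) fun h => ?_
    have h1 := G.sBilin_eq_zero_of_bBilin i _ h.symm
    rw [hnorm] at h1
    rw [mem_sphere_zero_iff_norm] at hc₀
    rw [hc₀] at h1
    norm_num at h1
  refine ⟨(q c₀)⁻¹, fun c' => ?_⟩
  let c : EuclideanSpace ℝ (Fin (l i)) := WithLp.toLp 2 c'
  change G.sBilin i (∑ p, c p • hφ.fn i p) (∑ p, c p • hφ.fn i p) ≤ (q c₀)⁻¹ * q c
  rw [hnorm]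
  rcases eq_or_ne c 0 with h0 | h0
  · rw [h0]; simp [q]
  have hcn : 0 < ‖c‖ := norm_pos_iff.2 h0
  have h1 : q c₀ ≤ q (‖c‖⁻¹ • c) := hmin (by
    rw [mem_sphere_zero_iff_norm, norm_smul, norm_inv, norm_norm, inv_mul_cancel₀ hcn.ne'])
  have h2 : q (‖c‖⁻¹ • c) = (‖c‖ ^ 2)⁻¹ * q c := by
    have e : ∑ p, (‖c‖⁻¹ • c) p • hφ.fn i p = ‖c‖⁻¹ • ∑ p, c p • hφ.fn i p := by
      rw [Finset.smul_sum]
      refine Finset.sum_congr rfl fun p _ => ?_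
      rw [PiLp.smul_apply, smul_eq_mul, mul_smul]
    simp only [q]
    rw [e]
    simp only [map_smul, LinearMap.smul_apply, smul_eq_mul]
    ring
  rw [h2, inv_mul_eq_div, le_div_iff₀ (by positivity)] at h1
  rw [inv_mul_eq_div, le_div_iff₀ hpos]
  linarith

/-- Basis functions of other elements vanish on `K_i`, so only the local ones contribute. -/
lemma IsAuxBasis.exists_coeff (hφ : G.IsAuxBasis l φ) {μ : Space d → ℝ} (hμ : μ ∈ Vaux φ)
    (i : ι) : ∃ c : Fin (l i) → ℝ, ∀ x ∈ G.elem i,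
      μ x = (∑ p, c p • hφ.fn i p : h1Space (G.elem i)).1 x := by
  classical
  induction hμ using Submodule.span_induction with
  | mem f hf =>
    obtain ⟨i', j', rfl⟩ := hf
    by_cases h : i' = i
    · subst h
      refine ⟨Pi.single j' 1, fun x _ => ?_⟩
      rw [Finset.sum_eq_single j' (fun q _ hq => by simp [Pi.single_eq_of_ne hq]) (by simp)]
      simp [IsAuxBasis.fn]
    · refine ⟨0, fun x hx => ?_⟩
      rw [hφ.zero_off i' j' x fun hx' => Set.disjoint_left.1 (G.disjoint_elem h) hx' hx]
      simp
  | zero => exact ⟨0, fun x _ => by simp⟩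
  | add f g _ _ hf hg =>
    obtain ⟨c, hc⟩ := hf
    obtain ⟨c', hc'⟩ := hg
    refine ⟨c + c', fun x hx => ?_⟩
    simp only [Pi.add_apply, add_smul, Finset.sum_add_distrib, Submodule.coe_add, hc x hx,
      hc' x hx]
  | smul a f _ hf =>
    obtain ⟨c, hc⟩ := hf
    refine ⟨a • c, fun x hx => ?_⟩
    simp only [Pi.smul_apply, smul_eq_mul, mul_smul, ← Finset.smul_sum, Submodule.coe_smul,
      hc x hx]

lemma IsAuxBasis.sum_mem_Vaux (hφ : G.IsAuxBasis l φ) (i : ι) (c : Fin (l i) → ℝ) :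
    (∑ p, c p • hφ.fn i p : h1Space (G.elem i)).1 ∈ Vaux φ := by
  simp only [Submodule.coe_sum, Submodule.coe_smul]
  exact Submodule.sum_mem _ fun p _ => Submodule.smul_mem _ _ (Submodule.subset_span ⟨i, p, rfl⟩)

lemma sLoc_congr {i : ι} {u u' v v' : Space d → ℝ} (hu : ∀ x ∈ G.elem i, u x = u' x)
    (hv : ∀ x ∈ G.elem i, v x = v' x) : G.sLoc i u v = G.sLoc i u' v' :=
  setIntegral_congr_fun (G.isOpen_elem i).measurableSet fun x hx => by
    simp only [hu x hx, hv x hx]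

/-- Finiteness of `C_π`, without which its `sSup` would be a default value and not an upper bound.
-/
lemma IsAuxBasis.bddAbove_ratio [Finite ι] (hφ : G.IsAuxBasis l φ) :
    BddAbove {r | ∃ i, ∃ μ ∈ Vaux φ, G.sLoc i μ μ ≠ 0 ∧
      r = G.sLoc i μ μ / ∫ x in G.elem i, G.bubble i x * G.kappa x * μ x ^ 2} := by
  choose M hM using hφ.exists_sBilin_le
  obtain ⟨B, hB⟩ := (Set.finite_range M).bddAbove
  refine ⟨B, ?_⟩
  rintro r ⟨i, μ, hμ, hs, rfl⟩
  obtain ⟨c, hc⟩ := hφ.exists_coeff hμ i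
  set m : h1Space (G.elem i) := ∑ p, c p • hφ.fn i p with hm
  have e1 : G.sLoc i μ μ = G.sBilin i m m := sLoc_congr hc hc
  have e2 : ∫ x in G.elem i, G.bubble i x * G.kappa x * μ x ^ 2 = G.bBilin i m m := by
    rw [bBilin_self]
    exact setIntegral_congr_fun (G.isOpen_elem i).measurableSet fun x hx => by
      simp only [hc x hx]
  rw [e1, e2]
  have hb : 0 < G.bBilin i m m := lt_of_le_of_ne (G.bBilin_self_nonneg i m) fun h => by
    rw [e1] at hs
    exact hs (G.sBilin_eq_zero_of_bBilin i m h.symm)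
  rw [div_le_iff₀ hb]
  exact (hM i c).trans (mul_le_mul_of_nonneg_right (hB ⟨i, rfl⟩) hb.le)

lemma IsAuxBasis.sBilin_le_Cpi [Finite ι] (hφ : G.IsAuxBasis l φ) (i : ι) (c : Fin (l i) → ℝ) :
    G.sBilin i (∑ p, c p • hφ.fn i p) (∑ p, c p • hφ.fn i p) ≤
      G.Cpi φ * G.bBilin i (∑ p, c p • hφ.fn i p) (∑ p, c p • hφ.fn i p) := by
  set m : h1Space (G.elem i) := ∑ p, c p • hφ.fn i p with hm
  by_cases hs : G.sBilin i m m = 0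
  · have h1 := G.bBilin_le_sBilin i m
    have h2 := G.bBilin_self_nonneg i m
    have h3 : G.bBilin i m m = 0 := le_antisymm (h1.trans hs.le) h2
    rw [hs, h3, mul_zero]
  have hb : 0 < G.bBilin i m m := lt_of_le_of_ne (G.bBilin_self_nonneg i m) fun h =>
    hs (G.sBilin_eq_zero_of_bBilin i m h.symm)
  rw [← div_le_iff₀ hb, bBilin_self]
  exact le_csSup hφ.bddAbove_ratio ⟨i, m.1, hφ.sum_mem_Vaux i c, hs, rfl⟩

lemma IsAuxBasis.one_le_Cpi [Finite ι] (hφ : G.IsAuxBasis l φ) (i : ι) : 1 ≤ G.Cpi φ := by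
  classical
  have h := hφ.sBilin_le_Cpi i (Pi.single ⟨0, hφ.one_le i⟩ 1)
  have h1 := G.bBilin_le_sBilin i
    (∑ p, (Pi.single ⟨0, hφ.one_le i⟩ 1 : Fin (l i) → ℝ) p • hφ.fn i p)
  have h2 := G.bBilin_self_nonneg i
    (∑ p, (Pi.single ⟨0, hφ.one_le i⟩ 1 : Fin (l i) → ℝ) p • hφ.fn i p)
  rw [hφ.sBilin_sum] at h h1
  have h3 : ∑ p, (Pi.single ⟨0, hφ.one_le i⟩ 1 : Fin (l i) → ℝ) p ^ 2 = 1 := by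
    rw [Finset.sum_eq_single ⟨0, hφ.one_le i⟩
      (fun q _ hq => by simp [Pi.single_eq_of_ne hq]) (by simp)]
    simp
  rw [h3] at h h1
  by_contra! hlt
  have h4 := mul_le_mul_of_nonneg_right hlt.le h2
  have h5 := le_antisymm h1 (by linarith)
  rw [h5] at h
  linarith

/-- The Gram matrix of the bubble form on the eigenfunctions is injective by definiteness, hence
invertible. The solution `m` is chosen so that `B m` has the same `s_i`-moments as `u`. -/
lemma IsAuxBasis.exists_projection (hφ : G.IsAuxBasis l φ) (i : ι) (u : h1Space (G.elem i)) :
    ∃ c : Fin (l i) → ℝ, ∀ j,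
      G.bBilin i (∑ p, c p • hφ.fn i p) (hφ.fn i j) = G.sBilin i u (hφ.fn i j) := by
  let T : (Fin (l i) → ℝ) →ₗ[ℝ] (Fin (l i) → ℝ) :=
    LinearMap.pi fun j => ((G.bBilin i).flip (hφ.fn i j)).comp
      (Fintype.linearCombination ℝ (hφ.fn i))
  have hT : ∀ c j, T c j = G.bBilin i (∑ p, c p • hφ.fn i p) (hφ.fn i j) := fun c j => by
    simp [T, Fintype.linearCombination_apply]
  have hinj : Function.Injective T := by
    rw [injective_iff_map_eq_zero]
    intro c hc
    have h1 : G.bBilin i (∑ p, c p • hφ.fn i p) (∑ p, c p • hφ.fn i p) = 0 := by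
      rw [map_sum]
      refine Finset.sum_eq_zero fun p _ => ?_
      rw [map_smul, ← hT, hc]
      simp
    have h2 := G.sBilin_eq_zero_of_bBilin i _ h1
    rw [hφ.sBilin_sum, Finset.sum_eq_zero_iff_of_nonneg fun _ _ => sq_nonneg _] at h2
    ext p
    exact pow_eq_zero_iff (two_ne_zero) |>.1 (h2 p (Finset.mem_univ p))
  obtain ⟨c, hc⟩ := LinearMap.injective_iff_surjective.1 hinj fun j => G.sBilin i u (hφ.fn i j)
  exact ⟨c, fun j => by rw [← hT, hc]⟩

lemma IsAuxBasis.sBilin_projection_le [Finite ι] (hφ : G.IsAuxBasis l φ) (i : ι)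
    (u : h1Space (G.elem i)) (c : Fin (l i) → ℝ)
    (hc : ∀ j, G.bBilin i (∑ p, c p • hφ.fn i p) (hφ.fn i j) = G.sBilin i u (hφ.fn i j)) :
    G.sBilin i (∑ p, c p • hφ.fn i p) (∑ p, c p • hφ.fn i p) ≤
      G.Cpi φ ^ 2 * G.sBilin i u u := by
  have h1 := hφ.sBilin_le_Cpi i c
  set m : h1Space (G.elem i) := ∑ p, c p • hφ.fn i p with hm
  have h2 : G.bBilin i m m = G.sBilin i u m := by
    conv_lhs => rw [hm, map_sum]
    conv_rhs => rw [hm, map_sum]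
    refine Finset.sum_congr rfl fun p _ => ?_
    rw [map_smul, map_smul, ← hm, hc]
  rw [h2] at h1
  -- Together with `s(m, m) ≤ C_π s(u, m)`, expanding this square gives the bound with the factor
  -- `C_π²`.
  have h3 := sBilin_self_nonneg i (G.Cpi φ • u - m)
  have h4 : G.sBilin i (G.Cpi φ • u - m) (G.Cpi φ • u - m) =
      G.Cpi φ ^ 2 * G.sBilin i u u - 2 * (G.Cpi φ * G.sBilin i u m) + G.sBilin i m m := by
    simp only [map_sub, LinearMap.sub_apply, map_smul, LinearMap.smul_apply, smul_eq_mul,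
      sBilin_comm i m u]
    ring
  linarith

end Projection

end PerforatedGrid

/-! ### The local lift: prescribed moments at controlled energy -/

namespace PerforatedGrid

variable {d : ℕ} {ι ν : Type*} [Fintype ν] {G : PerforatedGrid d ι ν}
  {l : ι → ℕ} {φ : (i : ι) → Fin (l i) → Space d → ℝ}

/-- Young's inequality with weight `N`: `2p‖y‖ ≤ N p² + ‖y‖²/N ≤ N p² + q`. The weight makes both
terms carry the same factor `1 + N`. -/
lemma norm_add_sq_le {x y : Space d} {N p q : ℝ} (hN : 0 < N) (hx : ‖x‖ ≤ p)
    (hy : ‖y‖ ^ 2 ≤ N * q) : ‖x + y‖ ^ 2 ≤ (1 + N) * (p ^ 2 + q) := by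
  have h1 : ‖x + y‖ ≤ p + ‖y‖ := (norm_add_le x y).trans (by linarith)
  have h2 : ‖x + y‖ ^ 2 ≤ (p + ‖y‖) ^ 2 := pow_le_pow_left₀ (norm_nonneg _) h1 2
  have h3 : 2 * N * (p * ‖y‖) ≤ N * (N * p ^ 2 + q) := by nlinarith [sq_nonneg (N * p - ‖y‖)]
  have h4 : 2 * (p * ‖y‖) ≤ N * p ^ 2 + q := le_of_mul_le_mul_left (by linarith) hN
  nlinarith

variable (G φ) in
/-- The constant in the local lifting estimate. -/
def liftConst [Fintype ι] (i : ι) : ℝ := (G.maxVerts : ℝ) ^ 2 * G.Cpi φ ^ 2 * (1 + G.eigenvalue i (l i))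

lemma integral_norm_sq_bubble_le [Fintype ι] (hd : d ≠ 0) (i : ι) (m : h1Space (G.elem i)) :
    ∫ x in G.elem i, ‖(G.elem i).indicator (fun x => G.bubbleExt i x •
      weakGrad (G.elem i) m.1 x + m.1 x • gradient (G.bubbleExt i) x) x‖ ^ 2 ≤
      (1 + (G.maxVerts : ℝ)) * (G.aBilin i m m + G.sBilin i m m) := by
  obtain ⟨C, hC⟩ := G.exists_lipschitzWith_bubbleExt i
  have hmH := MemH1.isH1_of_mem m
  have hβ := hmH.mul_lipschitz (G.isOpen_elem i) G.isOpen_compl_holes (G.elem_subset i) hC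
    (G.bubbleExt_nonneg i) (G.bubbleExt_le_one i) fun x hx hxe => G.bubbleExt_eq_zero hx.2 hxe
  have hN2 : (0 : ℝ) < G.maxVerts := by
    exact_mod_cast zero_lt_two.trans_le ((G.two_le_card_verts hd i).trans (G.card_verts_le i))
  have hmeas := (G.isOpen_elem i).measurableSet
  have hI1 : Integrable (fun x => ‖weakGrad (G.elem i) m.1 x‖ ^ 2) (volume.restrict (G.elem i)) :=
    integrable_norm_sq_of_memLp hmH.2.1
  have hI2 : Integrable (fun x => G.kappa x * m.1 x * m.1 x) (volume.restrict (G.elem i)) :=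
    integrable_weight_mul hmeas G.measurable_kappa (G.kappa_bounded i) hmH.1 hmH.1
  have e1 : G.aBilin i m m = ∫ x in G.elem i, ‖weakGrad (G.elem i) m.1 x‖ ^ 2 := by
    rw [aBilin_apply, energy]
    simp_rw [real_inner_self_eq_norm_sq]
  have e2 : G.sBilin i m m = ∫ x in G.elem i, G.kappa x * m.1 x * m.1 x := rfl
  rw [e1, e2, ← integral_add hI1 hI2, ← integral_const_mul]
  refine integral_mono_ae (integrable_norm_sq_of_memLp (hβ.mono G.isOpen_compl_holes
    (G.elem_subset i)).2.1) ((hI1.add hI2).const_mul _) ?_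
  filter_upwards [G.norm_gradient_bubble_sq_le i, ae_restrict_mem hmeas] with x hx hxe
  rw [Set.indicator_of_mem hxe]
  refine norm_add_sq_le hN2 ?_ ?_
  · rw [norm_smul, Real.norm_of_nonneg (G.bubbleExt_nonneg i x)]
    exact mul_le_of_le_one_left (norm_nonneg _) (G.bubbleExt_le_one i x)
  · rw [norm_smul, mul_pow, Real.norm_eq_abs, sq_abs, G.gradient_bubbleExt hxe]
    have h1 : ((G.verts i).card : ℝ) * G.kappa x ≤ G.maxVerts * G.kappa x :=
      mul_le_mul_of_nonneg_right (by exact_mod_cast G.card_verts_le i) (G.kappa_nonneg x)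
    have h2 := mul_le_mul_of_nonneg_left (hx.trans h1) (sq_nonneg (m.1 x))
    linarith

/-- The lift is `B m` with `m` the bubble projection of `u`. Its energy costs `1 + N` from the
product rule, `1 + λ_{l_i}` from the energy of `m`, and `C_π²` from the projection. -/
lemma IsAuxBasis.exists_lift [Fintype ι] (hd : d ≠ 0) (hφ : G.IsAuxBasis l φ) (i : ι)
    (u : h1Space (G.elem i)) :
    ∃ β gβ, IsH1 (Set.univ \ G.holes) β gβ ∧ (∀ x ∉ G.elem i, β x = 0) ∧
      (∀ x ∉ G.elem i, gβ x = 0) ∧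
      (∀ j, G.sLoc i β (φ i j) = G.sLoc i u.1 (φ i j)) ∧
      ∫ x in G.elem i, ‖gβ x‖ ^ 2 ≤ G.liftConst φ i * G.sLoc i u.1 u.1 := by
  obtain ⟨c, hc⟩ := hφ.exists_projection i u
  have hle := hφ.sBilin_projection_le i u c hc
  have hale := hφ.aBilin_sum_le i c
  obtain ⟨C, hC⟩ := G.exists_lipschitzWith_bubbleExt i
  obtain ⟨m, hm⟩ : ∃ m : h1Space (G.elem i), m = ∑ p, c p • hφ.fn i p := ⟨_, rfl⟩
  rw [← hm] at hc hle hale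
  have hmz : ∀ x ∉ G.elem i, m.1 x = 0 := fun x hx => by
    simp [hm, IsAuxBasis.fn, hφ.zero_off i _ x hx]
  clear hm
  have hβ := (MemH1.isH1_of_mem m).mul_lipschitz (G.isOpen_elem i) G.isOpen_compl_holes
    (G.elem_subset i) hC (G.bubbleExt_nonneg i) (G.bubbleExt_le_one i)
    fun x hx hxe => G.bubbleExt_eq_zero hx.2 hxe
  refine ⟨_, _, hβ, fun x hx => by simp only [hmz x hx, mul_zero],
    fun x hx => Set.indicator_of_notMem hx _, fun j => ?_, ?_⟩
  · have := hc j
    rw [bBilin_apply] at this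
    exact this
  refine (integral_norm_sq_bubble_le hd i m).trans ?_
  have hN2 : (2 : ℝ) ≤ G.maxVerts := by
    exact_mod_cast (G.two_le_card_verts hd i).trans (G.card_verts_le i)
  have hev := G.eigenvalue_nonneg (i := i) (hφ.one_le i)
  have h1 : G.aBilin i m m + G.sBilin i m m ≤ (1 + G.eigenvalue i (l i)) * G.sBilin i m m := by
    linarith
  have h2 : (1 + (G.maxVerts : ℝ)) ≤ (G.maxVerts : ℝ) ^ 2 := by nlinarith
  have hs0 := G.sLoc_self_nonneg i u.1
  rw [G.sBilin_apply i u u] at hle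
  calc (1 + (G.maxVerts : ℝ)) * (G.aBilin i m m + G.sBilin i m m)
      ≤ (1 + (G.maxVerts : ℝ)) * ((1 + G.eigenvalue i (l i)) * G.sBilin i m m) :=
        mul_le_mul_of_nonneg_left h1 (by linarith)
    _ ≤ (1 + (G.maxVerts : ℝ)) *
          ((1 + G.eigenvalue i (l i)) * (G.Cpi φ ^ 2 * G.sLoc i u.1 u.1)) :=
        mul_le_mul_of_nonneg_left (mul_le_mul_of_nonneg_left hle (by linarith)) (by linarith)
    _ ≤ (G.maxVerts : ℝ) ^ 2 *
          ((1 + G.eigenvalue i (l i)) * (G.Cpi φ ^ 2 * G.sLoc i u.1 u.1)) :=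
        mul_le_mul_of_nonneg_right h2
          (mul_nonneg (by linarith) (mul_nonneg (sq_nonneg _) hs0))
    _ = G.liftConst φ i * G.sLoc i u.1 u.1 := by rw [liftConst]; ring

/-! ### Comparing local constants with `Λ`, `Γ` and `D` -/

section Constants

lemma Dconst_eq [Fintype ι] (S : Set (Space d)) :
    G.Dconst φ S = (G.maxVerts : ℝ) ^ 2 * G.Cpi φ ^ 2 * (1 + G.Gam l S) := by
  rw [Dconst, CT, maxVerts]
  push_cast
  rfl

lemma finite_eigenvalues [Fintype ι] (S : Set (Space d)) (f : ι → ℝ) :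
    {t | ∃ i, (G.elem i ∩ S).Nonempty ∧ t = f i}.Finite := by
  refine (Set.finite_range f).subset ?_
  rintro t ⟨i, -, rfl⟩
  exact ⟨i, rfl⟩

lemma Lam_le [Fintype ι] {S : Set (Space d)} {j : ι} (hj : (G.elem j ∩ S).Nonempty) :
    G.Lam l S ≤ G.eigenvalue j (l j + 1) :=
  csInf_le (finite_eigenvalues S fun i => G.eigenvalue i (l i + 1)).bddBelow ⟨j, hj, rfl⟩

lemma Lam_pos [Fintype ι] (hgap : ∀ i, 0 < G.eigenvalue i (l i + 1)) {S : Set (Space d)} {j : ι}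
    (hj : (G.elem j ∩ S).Nonempty) : 0 < G.Lam l S := by
  have hne : {t | ∃ i, (G.elem i ∩ S).Nonempty ∧ t = G.eigenvalue i (l i + 1)}.Nonempty :=
    ⟨_, j, hj, rfl⟩
  obtain ⟨i, -, h⟩ := hne.csInf_mem (finite_eigenvalues S fun i => G.eigenvalue i (l i + 1))
  exact (hgap i).trans_eq h.symm

lemma le_Gam [Fintype ι] {S : Set (Space d)} {j : ι} (hj : (G.elem j ∩ S).Nonempty) :
    G.eigenvalue j (l j) ≤ G.Gam l S :=
  le_csSup (finite_eigenvalues S fun i => G.eigenvalue i (l i)).bddAbove ⟨j, hj, rfl⟩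

lemma liftConst_le [Fintype ι] {S : Set (Space d)} {j : ι} (hj : (G.elem j ∩ S).Nonempty) :
    G.liftConst φ j ≤ G.Dconst φ S := by
  rw [Dconst_eq, liftConst]
  have := le_Gam (l := l) hj
  gcongr

lemma IsAuxBasis.maxVerts_le_Dconst [Fintype ι] (hd : d ≠ 0) (hφ : G.IsAuxBasis l φ) {S : Set (Space d)}
    {j : ι} (hj : (G.elem j ∩ S).Nonempty) :
    (2 : ℝ) ≤ G.maxVerts ∧ (G.maxVerts : ℝ) ≤ G.Dconst φ S := by
  have hN2 : (2 : ℝ) ≤ G.maxVerts := by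
    exact_mod_cast (G.two_le_card_verts hd j).trans (G.card_verts_le j)
  refine ⟨hN2, ?_⟩
  have h1 := le_Gam (l := l) hj
  have h2 := G.eigenvalue_nonneg (i := j) (hφ.one_le j)
  have h3 := hφ.one_le_Cpi j
  rw [Dconst_eq]
  have h4 : (G.maxVerts : ℝ) ≤ (G.maxVerts : ℝ) ^ 2 := by nlinarith
  have h5 : (1 : ℝ) ≤ G.Cpi φ ^ 2 := one_le_pow₀ h3
  have h6 : 1 ≤ 1 + G.Gam l S := by linarith
  calc (G.maxVerts : ℝ) ≤ (G.maxVerts : ℝ) ^ 2 * 1 * 1 := by linarith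
    _ ≤ (G.maxVerts : ℝ) ^ 2 * G.Cpi φ ^ 2 * (1 + G.Gam l S) := by gcongr

lemma IsAuxBasis.elem_inter_oversample_nonempty (hφ : G.IsAuxBasis l φ) {i j : ι} {m : ℕ}
    (h : j ∈ G.layer i m) : (G.elem j ∩ G.oversample i m).Nonempty := by
  rw [Set.inter_eq_left.2 (G.elem_subset_oversample h)]
  exact hφ.elem_nonempty j

lemma IsAuxBasis.elem_inter_compl_nonempty (hφ : G.IsAuxBasis l φ) {i j : ι} {m : ℕ}
    (h : j ∉ G.layer i m) : (G.elem j ∩ (G.dom \ G.oversample i m)).Nonempty := by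
  obtain ⟨x, hx⟩ := hφ.elem_nonempty j
  exact ⟨x, hx, G.elem_subset_dom j hx, Set.disjoint_left.1 (G.disjoint_elem_oversample h) hx⟩

end Constants

/-! ### Orthogonality constraints and first-order optimality -/

section Orthogonality

lemma IsAuxBasis.sForm_eq [Fintype ι] (hφ : G.IsAuxBasis l φ) (ψ : Space d → ℝ) (i : ι) (j : Fin (l i)) :
    G.sForm ψ (φ i j) = G.sLoc i ψ (φ i j) := by
  classical
  rw [sForm, Finset.sum_eq_single i _ (by simp)]
  intro i' _ hi'
  rw [sLoc_congr (u' := ψ) (v' := 0) (fun x _ => rfl) fun x hx => hφ.zero_off i j x fun hx' =>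
    Set.disjoint_left.1 (G.disjoint_elem hi') hx hx']
  simp [sLoc]

lemma IsAuxBasis.isOrth_iff [Fintype ι] (hφ : G.IsAuxBasis l φ) (i : ι) (j : Fin (l i)) (ψ : Space d → ℝ) :
    G.IsOrth φ i j ψ ↔ G.sLoc i ψ (φ i j) = 1 ∧
      ∀ (i' : ι) (j' : Fin (l i')), (⟨i', j'⟩ : (i : ι) × Fin (l i)) ≠ ⟨i, j⟩ →
        G.sLoc i' ψ (φ i' j') = 0 := by
  simp only [IsOrth, hφ.sForm_eq]

lemma sLoc_add_left {i : ι} {u v w : Space d → ℝ} (hu : MemH1 (G.elem i) u)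
    (hv : MemH1 (G.elem i) v) (hw : MemH1 (G.elem i) w) :
    G.sLoc i (u + v) w = G.sLoc i u w + G.sLoc i v w := by
  have := (G.sBilin i).map_add₂ ⟨u, hu⟩ ⟨v, hv⟩ ⟨w, hw⟩
  exact this

lemma sLoc_smul_left {i : ι} {u w : Space d → ℝ} (c : ℝ) :
    G.sLoc i (c • u) w = c * G.sLoc i u w := by
  unfold sLoc
  rw [← integral_const_mul]
  congr 1 with x
  simp only [Pi.smul_apply, smul_eq_mul]
  ring

lemma sLoc_sub_left {i : ι} {u v w : Space d → ℝ} (hu : MemH1 (G.elem i) u)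
    (hv : MemH1 (G.elem i) v) (hw : MemH1 (G.elem i) w) :
    G.sLoc i (u - v) w = G.sLoc i u w - G.sLoc i v w := by
  have := (G.sBilin i).map_sub₂ ⟨u, hu⟩ ⟨v, hv⟩ ⟨w, hw⟩
  exact this

lemma memH1_elem_of_isH1 {u : Space d → ℝ} {g : Space d → Space d}
    (h : IsH1 (Set.univ \ G.holes) u g) (i : ι) : MemH1 (G.elem i) u :=
  (h.mono G.isOpen_compl_holes (G.elem_subset i)).memH1

lemma energy_dom_eq [Fintype ι] {u v : Space d → ℝ} {g g' : Space d → Space d}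
    (h : IsH1 (Set.univ \ G.holes) u g) (h' : IsH1 (Set.univ \ G.holes) v g') :
    energy G.dom u v = ∑ i, ∫ x in G.elem i, inner ℝ (g x) (g' x) := by
  have h1 := h.mono G.isOpen_compl_holes G.dom_subset
  have h2 := h'.mono G.isOpen_compl_holes G.dom_subset
  rw [energy_eq G.isOpen_dom h1 h2]
  exact G.setIntegral_dom (integrable_inner_of_memLp h1.2.1 h2.2.1)

lemma energy_dom_self [Fintype ι] {u : Space d → ℝ} {g : Space d → Space d}
    (h : IsH1 (Set.univ \ G.holes) u g) :
    energy G.dom u u = ∑ i, ∫ x in G.elem i, ‖g x‖ ^ 2 := by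
  rw [energy_dom_eq h h]
  simp_rw [real_inner_self_eq_norm_sq]

lemma eq_zero_of_forall_nonneg_quadratic {b c : ℝ} (h : ∀ t : ℝ, 0 ≤ 2 * t * b + t ^ 2 * c) :
    b = 0 := by
  by_contra hb
  rcases le_or_gt c 0 with hc | hc
  · have := h (-b)
    nlinarith [sq_pos_iff.2 hb, sq_nonneg b]
  · have := h (-b / c)
    have e : 2 * (-b / c) * b + (-b / c) ^ 2 * c = - (b ^ 2 / c) := by
      field_simp; ring
    rw [e] at this
    have := div_pos (sq_pos_iff.2 hb) hc
    linarith

/-- Euler–Lagrange equation: `ψ + t v` satisfies the same constraints for every `t`, so the linear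
term of the energy in `t` vanishes. -/
lemma IsMinimizer.energy_eq_zero [Fintype ι] (hφ : G.IsAuxBasis l φ) {i : ι} {j : Fin (l i)}
    {U : Set (Space d)} {ψ v : Space d → ℝ} (hψ : G.IsMinimizer φ i j U ψ) (hv : G.MemV U v)
    (hvφ : ∀ i' j', G.sLoc i' v (φ i' j') = 0) : energy G.dom ψ v = 0 := by
  obtain ⟨hV, hO, hmin⟩ := hψ
  rw [hφ.isOrth_iff] at hO
  obtain ⟨g, hg⟩ := hV.2.exists_isH1
  obtain ⟨gv, hgv⟩ := hv.2.exists_isH1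
  let p : h1Space G.dom := ⟨ψ, (hg.mono G.isOpen_compl_holes G.dom_subset).memH1⟩
  let q : h1Space G.dom := ⟨v, (hgv.mono G.isOpen_compl_holes G.dom_subset).memH1⟩
  refine eq_zero_of_forall_nonneg_quadratic (c := energy G.dom v v) fun t => ?_
  have hs : ∀ i' j', G.sLoc i' (ψ + t • v) (φ i' j') = G.sLoc i' ψ (φ i' j') := fun i' j' => by
    rw [sLoc_add_left (memH1_elem_of_isH1 hg i') (memH1_elem_of_isH1 (hgv.smul t) i') (hφ.memH1 i' j'),
      sLoc_smul_left, hvφ, mul_zero, add_zero]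
  have h1 := hmin (ψ + t • v) ⟨fun x hx => by simp [hV.1 x hx, hv.1 x hx],
    (hg.add (hgv.smul t)).memH1⟩ ((hφ.isOrth_iff i j _).2 ⟨by rw [hs, hO.1],
      fun i' j' h => by rw [hs, hO.2 i' j' h]⟩)
  have h2 : energy G.dom (ψ + t • v) (ψ + t • v) =
      energy G.dom ψ ψ + (2 * t * energy G.dom ψ v + t ^ 2 * energy G.dom v v) := by
    have hpq : energyForm G.isOpen_dom q p = energyForm G.isOpen_dom p q := energy_comm
    have e : energyForm G.isOpen_dom (p + t • q) (p + t • q) = energyForm G.isOpen_dom p p +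
        (2 * t * energyForm G.isOpen_dom p q + t ^ 2 * energyForm G.isOpen_dom q q) := by
      simp only [map_add, LinearMap.add_apply, map_smul, LinearMap.smul_apply, smul_eq_mul, hpq]
      ring
    exact e
  linarith

lemma MemV.mono {U U' : Set (Space d)} (h : U ⊆ U') {v : Space d → ℝ} (hv : G.MemV U v) :
    G.MemV U' v := ⟨fun x hx => hv.1 x fun hx' => hx (h hx'), hv.2⟩

end Orthogonality

end PerforatedGrid

/-! ### The corrected cutoff and the decay of the outer energy -/

namespace PerforatedGrid

variable {d : ℕ} {ι ν : Type*} [Fintype ι] [Fintype ν] {G : PerforatedGrid d ι ν}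
  {l : ι → ℕ} {φ : (i : ι) → Fin (l i) → Space d → ℝ}

/-- The local lifts live on disjoint elements, so their sum over `R` restricts to a single lift on
each element of `R`. -/
lemma IsAuxBasis.exists_correction (hd : d ≠ 0) (hφ : G.IsAuxBasis l φ) {u : Space d → ℝ}
    {g : Space d → Space d} (hu : IsH1 (Set.univ \ G.holes) u g) (R : Finset ι) :
    ∃ β gβ, IsH1 (Set.univ \ G.holes) β gβ ∧ (∀ x, (∀ i ∈ R, x ∉ G.elem i) → β x = 0) ∧
      (∀ i ∉ R, ∀ x ∈ G.elem i, β x = 0 ∧ gβ x = 0) ∧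
      ∀ i ∈ R, (∀ j, G.sLoc i β (φ i j) = G.sLoc i u (φ i j)) ∧
        ∫ x in G.elem i, ‖gβ x‖ ^ 2 ≤ G.liftConst φ i * G.sLoc i u u := by
  classical
  choose β gβ h1 h2 h3 h4 h5 using fun i => hφ.exists_lift hd i ⟨u, memH1_elem_of_isH1 hu i⟩
  have off : ∀ i i', i' ≠ i → ∀ x ∈ G.elem i, x ∉ G.elem i' := fun i i' h x hx hx' =>
    Set.disjoint_left.1 (G.disjoint_elem h) hx' hx
  have on1 : ∀ i ∈ R, ∀ x ∈ G.elem i, (∑ k ∈ R, β k) x = β i x := fun i hi x hx => by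
    rw [Finset.sum_apply, Finset.sum_eq_single i
      (fun i' _ h => h2 i' x (off i i' h x hx)) (fun h => absurd hi h)]
  have on2 : ∀ i ∈ R, ∀ x ∈ G.elem i, (∑ k ∈ R, gβ k) x = gβ i x := fun i hi x hx => by
    rw [Finset.sum_apply, Finset.sum_eq_single i
      (fun i' _ h => h3 i' x (off i i' h x hx)) (fun h => absurd hi h)]
  refine ⟨∑ k ∈ R, β k, ∑ k ∈ R, gβ k, IsH1.sum R fun k _ => h1 k, fun x hx => ?_,
    fun i hi x hx => ⟨?_, ?_⟩, fun i hi => ⟨fun j => ?_, ?_⟩⟩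
  · rw [Finset.sum_apply]
    exact Finset.sum_eq_zero fun k hk => h2 k x (hx k hk)
  · rw [Finset.sum_apply]
    exact Finset.sum_eq_zero fun k hk => h2 k x (off i k (fun h => hi (h ▸ hk)) x hx)
  · rw [Finset.sum_apply]
    exact Finset.sum_eq_zero fun k hk => h3 k x (off i k (fun h => hi (h ▸ hk)) x hx)
  · rw [sLoc_congr (on1 i hi) fun x _ => rfl]
    exact h4 i j
  · rw [setIntegral_congr_fun (g := fun x => ‖gβ i x‖ ^ 2) (G.isOpen_elem i).measurableSet
      fun x hx => by simp only [on2 i hi x hx]]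
    exact h5 i

omit [Fintype ι] in
lemma gradient_eq_zero_of_const_on {U : Set (Space d)} (hU : IsOpen U) {f : Space d → ℝ} {c : ℝ}
    (h : ∀ x ∈ U, f x = c) {x : Space d} (hx : x ∈ U) : gradient f x = 0 := by
  have : f =ᶠ[𝓝 x] fun _ => c := by
    filter_upwards [hU.mem_nhds hx] with y hy using h y hy
  rw [this.gradient_eq, gradient_fun_const]

lemma exists_cut {ψ : Space d → ℝ} {g : Space d → Space d} (hψ : ∀ x ∉ G.dom, ψ x = 0)
    (hg : IsH1 (Set.univ \ G.holes) ψ g) (i : ι) (m : ℕ) :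
    ∃ (X : Space d → ℝ) (gX : Space d → Space d) (ξ : Space d → ℝ),
      IsH1 (Set.univ \ G.holes) X gX ∧ Continuous ξ ∧ (∀ x, 0 ≤ ξ x) ∧ (∀ x, ξ x ≤ 1) ∧
      (∀ x, X x = ξ x * ψ x) ∧ (∀ x ∉ G.oversample i (m + 1), X x = ψ x) ∧
      (∀ j ∈ G.layer i m, ∀ x ∈ G.elem j, X x = 0 ∧ gX x = 0) ∧
      (∀ j ∉ G.layer i (m + 1), ∀ x ∈ G.elem j, X x = ψ x ∧ gX x = g x) ∧
      ∀ j, ∀ᵐ x ∂(volume.restrict (G.elem j)),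
        ‖gX x - ξ x • g x‖ ^ 2 ≤ G.maxVerts * (G.kappa x * ψ x * ψ x) := by
  obtain ⟨ξ, C, hL, h0, h1, hin, hout, hgr⟩ := G.exists_cutoff i m
  have hX := hg.mul_lipschitz G.isOpen_compl_holes G.isOpen_compl_holes subset_rfl hL h0 h1
    fun x hx hx' => absurd hx hx'
  have hgX : ∀ j, ∀ x ∈ G.elem j, (Set.univ \ G.holes).indicator
      (fun x => ξ x • g x + ψ x • gradient ξ x) x = ξ x • g x + ψ x • gradient ξ x :=
    fun j x hx => Set.indicator_of_mem (G.elem_subset j hx) _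
  refine ⟨_, _, ξ, hX, hL.continuous, h0, h1, fun x => rfl, fun x hx => ?_, fun j hj x hx => ?_,
    fun j hj x hx => ?_, fun j => ?_⟩
  · by_cases hxd : x ∈ G.dom
    · obtain ⟨j, hj, hxj⟩ := G.mem_cell_of_notMem_oversample hxd hx
      simp only [hout j hj x hxj, one_mul]
    · simp only [hψ x hxd, mul_zero]
  · have hz : ∀ y ∈ G.elem j, ξ y = 0 := fun y hy => hin j hj y (G.elem_subset_cell j hy)
    rw [hgX j x hx, gradient_eq_zero_of_const_on (G.isOpen_elem j) hz hx, hz x hx]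
    simp
  · have hz : ∀ y ∈ G.elem j, ξ y = 1 := fun y hy => hout j hj y (G.elem_subset_cell j hy)
    rw [hgX j x hx, gradient_eq_zero_of_const_on (G.isOpen_elem j) hz hx, hz x hx]
    simp
  · filter_upwards [hgr j, ae_restrict_mem (G.isOpen_elem j).measurableSet] with x hx hxe
    rw [hgX j x hxe, add_sub_cancel_left, norm_smul, mul_pow, Real.norm_eq_abs, sq_abs]
    have h2 : ((G.verts j).card : ℝ) * G.kappa x ≤ G.maxVerts * G.kappa x :=
      mul_le_mul_of_nonneg_right (by exact_mod_cast G.card_verts_le j) (G.kappa_nonneg x)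
    have h3 := mul_le_mul_of_nonneg_left (hx.trans h2) (sq_nonneg (ψ x))
    linarith

omit [Fintype ι] in
lemma sLoc_self_mono {i : ι} {u v : Space d → ℝ} (hu : MemH1 (G.elem i) u)
    (hv : MemH1 (G.elem i) v) (h : ∀ x, |u x| ≤ |v x|) : G.sLoc i u u ≤ G.sLoc i v v := by
  have hm := (G.isOpen_elem i).measurableSet
  refine integral_mono
    (integrable_weight_mul hm G.measurable_kappa (G.kappa_bounded i) hu.1 hu.1)
    (integrable_weight_mul hm G.measurable_kappa (G.kappa_bounded i) hv.1 hv.1) fun x => ?_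
  simp only [mul_assoc]
  refine mul_le_mul_of_nonneg_left ?_ (G.kappa_nonneg x)
  rw [← pow_two, ← pow_two]
  exact sq_le_sq.2 (h x)

/-- The function `ξ ψ`, with a cutoff `ξ` between `m` and `m + 1` layers, corrected to be
orthogonal to the auxiliary space. -/
lemma IsAuxBasis.exists_test (hd : d ≠ 0) (hφ : G.IsAuxBasis l φ) {i : ι} {j : Fin (l i)}
    {ψ : Space d → ℝ} {g : Space d → Space d} (hψ : ∀ x ∉ G.dom, ψ x = 0)
    (hO : G.IsOrth φ i j ψ) (hg : IsH1 (Set.univ \ G.holes) ψ g) (m : ℕ) :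
    ∃ (Z : Space d → ℝ) (gZ : Space d → Space d), IsH1 (Set.univ \ G.holes) Z gZ ∧
      (∀ x ∉ G.oversample i (m + 1), Z x = ψ x) ∧
      (∀ i' j', G.sLoc i' Z (φ i' j') = 0) ∧
      (∀ k ∈ G.layer i m, ∀ x ∈ G.elem k, gZ x = 0) ∧
      (∀ k ∉ G.layer i (m + 1), ∀ x ∈ G.elem k, gZ x = g x) ∧
      ∀ k ∈ G.layer i (m + 1), k ∉ G.layer i m → ∃ (ξ : Space d → ℝ) (h b : Space d → Space d),
        (∀ x, 0 ≤ ξ x) ∧ (∀ x, ξ x ≤ 1) ∧ (∀ x, gZ x = ξ x • g x + h x - b x) ∧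
        MemLp h 2 (volume.restrict (G.elem k)) ∧ MemLp b 2 (volume.restrict (G.elem k)) ∧
        ∫ x in G.elem k, ‖h x‖ ^ 2 ≤ G.maxVerts * G.sLoc k ψ ψ ∧
        ∫ x in G.elem k, ‖b x‖ ^ 2 ≤ G.liftConst φ k * G.sLoc k ψ ψ := by
  classical
  obtain ⟨X, gX, ξ, hX, hξ, h0, h1, hXe, hXo, hin, hout, hae⟩ := exists_cut hψ hg i m
  rw [hφ.isOrth_iff] at hO
  set R : Finset ι := Finset.univ.filter fun k => k ∈ G.layer i (m + 1) ∧ k ∉ G.layer i m with hR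
  have hRm : ∀ k, k ∈ R ↔ k ∈ G.layer i (m + 1) ∧ k ∉ G.layer i m := fun k => by simp [hR]
  obtain ⟨β, gβ, hβ, hβ0, hβR, hβc⟩ := hφ.exists_correction hd hX R
  refine ⟨X - β, gX - gβ, hX.sub hβ, fun x hx => ?_, fun i' j' => ?_, fun k hk x hx => ?_,
    fun k hk x hx => ?_, fun k hk hk' => ⟨ξ, fun x => gX x - ξ x • g x, gβ, h0, h1, fun x => ?_,
      ?_, ?_, ?_, ?_⟩⟩
  · rw [Pi.sub_apply, hXo x hx, hβ0 x fun k hk hxk =>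
      hx (G.elem_subset_oversample ((hRm k).1 hk).1 hxk), sub_zero]
  · rw [sLoc_sub_left (memH1_elem_of_isH1 hX i') (memH1_elem_of_isH1 hβ i') (hφ.memH1 i' j')]
    by_cases hi' : i' ∈ R
    · rw [(hβc i' hi').1 j', sub_self]
    · have e1 : G.sLoc i' β (φ i' j') = 0 := by
        rw [sLoc_congr (u' := 0) (v' := φ i' j') (fun x hx => (hβR i' hi' x hx).1) fun x _ => rfl]
        simp [sLoc]
      rw [e1, sub_zero]
      by_cases hl : i' ∈ G.layer i m
      · rw [sLoc_congr (u' := 0) (v' := φ i' j') (fun x hx => (hin i' hl x hx).1) fun x _ => rfl]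
        simp [sLoc]
      · have hl' : i' ∉ G.layer i (m + 1) := fun h => hi' ((hRm i').2 ⟨h, hl⟩)
        rw [sLoc_congr (u' := ψ) (v' := φ i' j') (fun x hx => (hout i' hl' x hx).1) fun x _ => rfl]
        -- The only nonzero moment of `ψ` is on `K_i`, which lies inside every layer and so never
        -- beyond the ring.
        refine hO.2 i' j' fun h => hl ?_
        have : i' = i := congrArg Sigma.fst h
        rw [this]
        exact G.mem_layer_self i m
  · rw [Pi.sub_apply, (hin k hk x hx).2, (hβR k (fun h => ((hRm k).1 h).2 hk) x hx).2, sub_zero]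
  · rw [Pi.sub_apply, (hout k hk x hx).2, (hβR k (fun h => hk ((hRm k).1 h).1) x hx).2, sub_zero]
  · simp
  · have l1 := (hX.mono G.isOpen_compl_holes (G.elem_subset k)).2.1
    have l2 := (hg.mono G.isOpen_compl_holes (G.elem_subset k)).2.1
    refine l1.sub (MemLp.of_le l2 (hξ.aestronglyMeasurable.smul l2.1)
      (Eventually.of_forall fun x => ?_))
    rw [norm_smul, Real.norm_of_nonneg (h0 x)]
    exact mul_le_of_le_one_left (norm_nonneg _) (h1 x)
  · exact (hβ.mono G.isOpen_compl_holes (G.elem_subset k)).2.1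
  · rw [sLoc, ← integral_const_mul]
    have hψk := memH1_elem_of_isH1 hg k
    refine integral_mono_of_nonneg (Eventually.of_forall fun x => sq_nonneg _)
      ((integrable_weight_mul (G.isOpen_elem k).measurableSet G.measurable_kappa
        (G.kappa_bounded k) hψk.1 hψk.1).const_mul _) (hae k)
  · refine (hβc k ((hRm k).2 ⟨hk, hk'⟩)).2.trans (mul_le_mul_of_nonneg_left ?_ ?_)
    · refine sLoc_self_mono (memH1_elem_of_isH1 hX k) (memH1_elem_of_isH1 hg k) fun x => ?_
      rw [hXe, abs_mul, abs_of_nonneg (h0 x)]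
      exact mul_le_of_le_one_left (abs_nonneg _) (h1 x)
    · have := G.eigenvalue_nonneg (i := k) (hφ.one_le k)
      rw [liftConst]
      positivity

omit [Fintype ι] in
lemma IsAuxBasis.poincare (hφ : G.IsAuxBasis l φ) {k : ι} {ψ : Space d → ℝ}
    {g : Space d → Space d} (hg : IsH1 (Set.univ \ G.holes) ψ g)
    (h : ∀ j, G.sLoc k ψ (φ k j) = 0) :
    G.eigenvalue k (l k + 1) * G.sLoc k ψ ψ ≤ ∫ x in G.elem k, ‖g x‖ ^ 2 := by
  have hk := hg.mono G.isOpen_compl_holes (G.elem_subset k)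
  have h1 := hφ.eigenvalue_mul_le k ⟨ψ, hk.memH1⟩ h
  rw [aBilin_apply, energy_eq (G.isOpen_elem k) hk hk] at h1
  simp_rw [real_inner_self_eq_norm_sq] at h1
  exact h1

omit [Fintype ι] in
lemma young_inner {x y : Space d} {ρ : ℝ} (hρ : 0 < ρ) :
    |(inner ℝ x y : ℝ)| ≤ (ρ * ‖x‖ ^ 2 + ρ⁻¹ * ‖y‖ ^ 2) / 2 := by
  refine (abs_real_inner_le_norm x y).trans ?_
  have h1 : 0 ≤ ρ⁻¹ * (ρ * ‖x‖ - ‖y‖) ^ 2 := by positivity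
  have h2 : ρ⁻¹ * (ρ * ‖x‖ - ‖y‖) ^ 2 = ρ * ‖x‖ ^ 2 + ρ⁻¹ * ‖y‖ ^ 2 - 2 * (‖x‖ * ‖y‖) := by
    field_simp
    ring
  linarith

/-- The energy of a function outside of `m` layers. -/
def outerEnergy (G : PerforatedGrid d ι ν) (g : Space d → Space d) (i : ι) (m : ℕ) : ℝ :=
  open Classical in
  ∑ k, if k ∈ G.layer i m then 0 else ∫ x in G.elem k, ‖g x‖ ^ 2

omit [Fintype ι] in
-- The term `ξ‖g‖²` is nonnegative and dropped. The two cross terms are split by Young with `ρ =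
-- √D/√Λ`; since both remainders are at most `D s ≤ ρ² ∫‖g‖²`, this choice balances them and each
-- cross term costs `ρ ∫‖g‖²`.
lemma ring_lower_bound {k : ι} {g gZ h b : Space d → Space d} {ξ : Space d → ℝ} {Λ D s : ℝ}
    (hΛ : 0 < Λ) (hD : 0 < D) (hg : MemLp g 2 (volume.restrict (G.elem k)))
    (hgZ : MemLp gZ 2 (volume.restrict (G.elem k)))
    (hh : MemLp h 2 (volume.restrict (G.elem k))) (hb : MemLp b 2 (volume.restrict (G.elem k)))
    (h0 : ∀ x, 0 ≤ ξ x) (hZ : ∀ x, gZ x = ξ x • g x + h x - b x)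
    (h1 : ∫ x in G.elem k, ‖h x‖ ^ 2 ≤ D * s) (h2 : ∫ x in G.elem k, ‖b x‖ ^ 2 ≤ D * s)
    (hs : Λ * s ≤ ∫ x in G.elem k, ‖g x‖ ^ 2) :
    -(2 * √D / √Λ * ∫ x in G.elem k, ‖g x‖ ^ 2) ≤ ∫ x in G.elem k, inner ℝ (g x) (gZ x) := by
  set A := ∫ x in G.elem k, ‖g x‖ ^ 2 with hA
  set ρ := √D / √Λ with hρ
  have hρ0 : 0 < ρ := div_pos (Real.sqrt_pos.2 hD) (Real.sqrt_pos.2 hΛ)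
  have ig := integrable_norm_sq_of_memLp hg
  have ih := integrable_norm_sq_of_memLp hh
  have ib := integrable_norm_sq_of_memLp hb
  have key : ∫ x in G.elem k, (-(ρ * ‖g x‖ ^ 2) - ρ⁻¹ / 2 * ‖h x‖ ^ 2 - ρ⁻¹ / 2 * ‖b x‖ ^ 2) ≤
      ∫ x in G.elem k, inner ℝ (g x) (gZ x) := by
    refine integral_mono (((ig.const_mul ρ).neg.sub (ih.const_mul _)).sub (ib.const_mul _))
      (integrable_inner_of_memLp hg hgZ) fun x => ?_
    simp only
    rw [hZ, inner_sub_right, inner_add_right, real_inner_smul_right, real_inner_self_eq_norm_sq]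
    have y1 := abs_le.1 (young_inner (x := g x) (y := h x) hρ0)
    have y2 := abs_le.1 (young_inner (x := g x) (y := b x) hρ0)
    have y3 : 0 ≤ ξ x * ‖g x‖ ^ 2 := mul_nonneg (h0 x) (sq_nonneg _)
    linarith [y1.1, y2.2]
  have e1 : ∫ x in G.elem k,
      (-(ρ * ‖g x‖ ^ 2) - ρ⁻¹ / 2 * ‖h x‖ ^ 2 - ρ⁻¹ / 2 * ‖b x‖ ^ 2) =
      -(ρ * A) - ρ⁻¹ / 2 * (∫ x in G.elem k, ‖h x‖ ^ 2) -
        ρ⁻¹ / 2 * ∫ x in G.elem k, ‖b x‖ ^ 2 := by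
    rw [integral_sub (f := fun x => -(ρ * ‖g x‖ ^ 2) - ρ⁻¹ / 2 * ‖h x‖ ^ 2)
      ((ig.const_mul ρ).neg.sub (ih.const_mul _)) (ib.const_mul _),
      integral_sub (f := fun x => -(ρ * ‖g x‖ ^ 2)) (ig.const_mul ρ).neg (ih.const_mul _),
      integral_neg, integral_const_mul, integral_const_mul, integral_const_mul]
  rw [e1] at key
  refine le_trans ?_ key
  have hDΛ : ρ⁻¹ * (D / Λ) = ρ := by
    have e : D / Λ = ρ * ρ := by
      rw [hρ, div_mul_div_comm, Real.mul_self_sqrt hD.le, Real.mul_self_sqrt hΛ.le]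
    rw [e]
    field_simp
  have h3 : D * s ≤ D / Λ * A := by
    rw [div_mul_eq_mul_div, le_div_iff₀ hΛ]
    nlinarith
  have h4 : ρ⁻¹ * (D * s) ≤ ρ * A := by
    calc ρ⁻¹ * (D * s) ≤ ρ⁻¹ * (D / Λ * A) := mul_le_mul_of_nonneg_left h3 (by positivity)
      _ = ρ * A := by rw [← mul_assoc, hDΛ]
  have h5 := mul_le_mul_of_nonneg_left h1 (inv_pos.2 hρ0).le
  have h6 := mul_le_mul_of_nonneg_left h2 (inv_pos.2 hρ0).le
  have e2 : 2 * √D / √Λ = 2 * ρ := by rw [hρ]; ring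
  rw [e2]
  linarith

/-- Testing optimality of `ψ` with `Z` bounds the energy beyond the ring by `c` times the ring
energy. The latter is a difference of outer energies, so moving it across produces a contraction. -/
lemma IsMinimizer.outerEnergy_succ_le (hd : d ≠ 0) (hφ : G.IsAuxBasis l φ) {i : ι}
    {j : Fin (l i)} {ψ : Space d → ℝ} {g : Space d → Space d}
    (hψ : G.IsMinimizer φ i j G.dom ψ) (hg : IsH1 (Set.univ \ G.holes) ψ g) (m : ℕ) {Λ D : ℝ}
    (hΛ : 0 < Λ) (hD : 0 < D) (hN : (G.maxVerts : ℝ) ≤ D)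
    (hΛk : ∀ k ∈ G.layer i (m + 1), Λ ≤ G.eigenvalue k (l k + 1))
    (hDk : ∀ k ∈ G.layer i (m + 1), G.liftConst φ k ≤ D) :
    G.outerEnergy g i (m + 1) * (1 + √Λ / (2 * √D)) ≤ G.outerEnergy g i m := by
  classical
  obtain ⟨Z, gZ, hZ, hZo, hZφ, hin, hout, hring⟩ := hφ.exists_test hd hψ.1.1 hψ.2.1 hg m
  have hZV : G.MemV G.dom Z := ⟨fun x hx => by
    rw [hZo x fun h => hx (G.oversample_subset_dom i _ h), hψ.1.1 x hx], hZ.memH1⟩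
  have horth := hψ.energy_eq_zero hφ hZV hZφ
  rw [energy_dom_eq hg hZ] at horth
  have hO := (hφ.isOrth_iff i j ψ).1 hψ.2.1
  set c := 2 * √D / √Λ with hc
  have hc0 : 0 < c := by positivity
  -- The left side is arranged to equal `0` on inner cells, `-c` times the cell energy on ring
  -- cells, and the full cell energy beyond the ring.
  have hcell : ∀ k, (1 + c) * (if k ∈ G.layer i (m + 1) then 0 else ∫ x in G.elem k, ‖g x‖ ^ 2) -
      c * (if k ∈ G.layer i m then 0 else ∫ x in G.elem k, ‖g x‖ ^ 2) ≤
      ∫ x in G.elem k, inner ℝ (g x) (gZ x) := by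
    intro k
    have hmeas := (G.isOpen_elem k).measurableSet
    by_cases h1 : k ∈ G.layer i m
    · rw [if_pos h1, if_pos (G.layer_subset_succ i m h1), setIntegral_congr_fun (g := fun _ => 0)
        hmeas fun x hx => by simp only [hin k h1 x hx, inner_zero_right]]
      simp
    by_cases h2 : k ∈ G.layer i (m + 1)
    · rw [if_neg h1, if_pos h2, mul_zero, zero_sub]
      obtain ⟨ξ, h, b, hξ0, hξ1, hZe, hh, hb, hih, hib⟩ := hring k h2 h1
      have hs0 := G.sLoc_self_nonneg k ψ
      refine ring_lower_bound (s := G.sLoc k ψ ψ) hΛ hD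
        (hg.mono G.isOpen_compl_holes (G.elem_subset k)).2.1
        (hZ.mono G.isOpen_compl_holes (G.elem_subset k)).2.1 hh hb hξ0 hZe
        (hih.trans (mul_le_mul_of_nonneg_right hN hs0))
        (hib.trans (mul_le_mul_of_nonneg_right (hDk k h2) hs0)) ?_
      refine (mul_le_mul_of_nonneg_right (hΛk k h2) hs0).trans (hφ.poincare hg fun j' =>
        hO.2 k j' fun h => h1 ?_)
      have : k = i := congrArg Sigma.fst h
      rw [this]
      exact G.mem_layer_self i m
    · have e : ∫ x in G.elem k, inner ℝ (g x) (gZ x) = ∫ x in G.elem k, ‖g x‖ ^ 2 :=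
        setIntegral_congr_fun hmeas fun x hx => by
          simp only [hout k h2 x hx, real_inner_self_eq_norm_sq]
      rw [if_neg h1, if_neg h2, e]
      linarith
  have hsum := Finset.sum_le_sum fun k (_ : k ∈ Finset.univ) => hcell k
  rw [horth, Finset.sum_sub_distrib, ← Finset.mul_sum, ← Finset.mul_sum] at hsum
  have hsum' : (1 + c) * G.outerEnergy g i (m + 1) ≤ c * G.outerEnergy g i m := by
    unfold outerEnergy
    linarith
  have e : √Λ / (2 * √D) = c⁻¹ := by rw [hc, inv_div]
  rw [e]
  have h3 := mul_le_mul_of_nonneg_left hsum' (inv_pos.2 hc0).le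
  rw [inv_mul_cancel_left₀ hc0.ne'] at h3
  refine le_trans (le_of_eq ?_) h3
  field_simp
  ring

omit [Fintype ι] in
lemma norm_sq_three_le {x y z : Space d} : ‖x + y - z‖ ^ 2 ≤ 3 * (‖x‖ ^ 2 + ‖y‖ ^ 2 + ‖z‖ ^ 2) := by
  have h1 : ‖x + y - z‖ ≤ ‖x‖ + ‖y‖ + ‖z‖ :=
    (norm_sub_le _ _).trans (add_le_add_left (norm_add_le x y) _)
  have h2 := pow_le_pow_left₀ (norm_nonneg _) h1 2
  nlinarith [sq_nonneg (‖x‖ - ‖y‖), sq_nonneg (‖x‖ - ‖z‖), sq_nonneg (‖y‖ - ‖z‖)]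

/-- On a ring cell the three pieces of the gradient give at most `3(1 + 2Dc)` times the cell energy,
and `1 + Dc ≤ D(1 + c)` turns this into `6D(1 + c)`. Beyond the ring `Z` and `ψ` have the same
gradient. -/
lemma energy_test_le {i : ι} {ψ : Space d → ℝ} {g gZ : Space d → Space d} {Z : Space d → ℝ}
    {m : ℕ} {c D : ℝ} (hg : IsH1 (Set.univ \ G.holes) ψ g) (hZ : IsH1 (Set.univ \ G.holes) Z gZ)
    (hin : ∀ k ∈ G.layer i m, ∀ x ∈ G.elem k, gZ x = 0)
    (hout : ∀ k ∉ G.layer i (m + 1), ∀ x ∈ G.elem k, gZ x = g x)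
    (hring : ∀ k ∈ G.layer i (m + 1), k ∉ G.layer i m →
      ∃ (ξ : Space d → ℝ) (h b : Space d → Space d),
        (∀ x, 0 ≤ ξ x) ∧ (∀ x, ξ x ≤ 1) ∧ (∀ x, gZ x = ξ x • g x + h x - b x) ∧
        MemLp h 2 (volume.restrict (G.elem k)) ∧ MemLp b 2 (volume.restrict (G.elem k)) ∧
        ∫ x in G.elem k, ‖h x‖ ^ 2 ≤ G.maxVerts * G.sLoc k ψ ψ ∧
        ∫ x in G.elem k, ‖b x‖ ^ 2 ≤ G.liftConst φ k * G.sLoc k ψ ψ)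
    (hc : 0 ≤ c) (hD : 1 ≤ D) (hN : (G.maxVerts : ℝ) ≤ D)
    (hs : ∀ k ∉ G.layer i m, G.sLoc k ψ ψ ≤ c * ∫ x in G.elem k, ‖g x‖ ^ 2)
    (hDk : ∀ k ∈ G.layer i (m + 1), G.liftConst φ k ≤ D) :
    energy G.dom Z Z ≤ 6 * D * (1 + c) * G.outerEnergy g i m := by
  classical
  rw [energy_dom_self hZ, outerEnergy, Finset.mul_sum]
  refine Finset.sum_le_sum fun k _ => ?_
  have hmeas := (G.isOpen_elem k).measurableSet
  have hA : 0 ≤ ∫ x in G.elem k, ‖g x‖ ^ 2 := integral_nonneg fun x => sq_nonneg _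
  have hDc : 1 + D * c ≤ D * (1 + c) := by nlinarith
  have hDc0 : 0 ≤ D * c := by positivity
  by_cases h1 : k ∈ G.layer i m
  · rw [if_pos h1, mul_zero, setIntegral_congr_fun (g := fun _ => 0)
      hmeas fun x hx => by simp [hin k h1 x hx]]
    simp
  rw [if_neg h1]
  by_cases h2 : k ∈ G.layer i (m + 1)
  · obtain ⟨ξ, h, b, hξ0, hξ1, hZe, hh, hb, hih, hib⟩ := hring k h2 h1
    have ig := integrable_norm_sq_of_memLp (hg.mono G.isOpen_compl_holes (G.elem_subset k)).2.1
    have ih := integrable_norm_sq_of_memLp hh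
    have ib := integrable_norm_sq_of_memLp hb
    have hs0 := G.sLoc_self_nonneg k ψ
    have h3 : ∫ x in G.elem k, ‖gZ x‖ ^ 2 ≤
        ∫ x in G.elem k, 3 * (‖g x‖ ^ 2 + ‖h x‖ ^ 2 + ‖b x‖ ^ 2) := by
      refine integral_mono (integrable_norm_sq_of_memLp
        (hZ.mono G.isOpen_compl_holes (G.elem_subset k)).2.1)
        (((ig.add ih).add ib).const_mul 3) fun x => ?_
      simp only
      rw [hZe]
      refine norm_sq_three_le.trans ?_
      have : ‖ξ x • g x‖ ≤ ‖g x‖ := by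
        rw [norm_smul, Real.norm_of_nonneg (hξ0 x)]
        exact mul_le_of_le_one_left (norm_nonneg _) (hξ1 x)
      have := pow_le_pow_left₀ (norm_nonneg _) this 2
      linarith
    rw [integral_const_mul, integral_add (f := fun x => ‖g x‖ ^ 2 + ‖h x‖ ^ 2) (ig.add ih) ib,
      integral_add ig ih] at h3
    have h4 := hih.trans (mul_le_mul_of_nonneg_right hN hs0)
    have h5 := hib.trans (mul_le_mul_of_nonneg_right (hDk k h2) hs0)
    have h6 := mul_le_mul_of_nonneg_left (hs k h1) (by linarith : 0 ≤ D)
    have h7 := mul_le_mul_of_nonneg_right hDc hA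
    have h8 := mul_nonneg hDc0 hA
    nlinarith
  · rw [setIntegral_congr_fun (g := fun x => ‖g x‖ ^ 2) hmeas fun x hx => by
      simp only [hout k h2 x hx]]
    refine le_mul_of_one_le_left hA ?_
    nlinarith

end PerforatedGrid

/-! ### Comparison of the two minimizers -/

namespace PerforatedGrid

variable {d : ℕ} {ι ν : Type*} [Fintype ι] [Fintype ν] {G : PerforatedGrid d ι ν}
  {l : ι → ℕ} {φ : (i : ι) → Fin (l i) → Space d → ℝ}

/-- Pythagoras: `v = ψms - ψ + Z` vanishes off `U` and has no auxiliary moments, so it is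
energy-orthogonal to both minimizers, and `Z = (ψ - ψms) + v`. -/
lemma IsMinimizer.energy_sub_le (hφ : G.IsAuxBasis l φ) {i : ι} {j : Fin (l i)}
    {U : Set (Space d)} (hU : U ⊆ G.dom) {ψ ψms Z : Space d → ℝ} {gZ : Space d → Space d}
    (hψ : G.IsMinimizer φ i j G.dom ψ) (hψms : G.IsMinimizer φ i j U ψms)
    (hZ : IsH1 (Set.univ \ G.holes) Z gZ) (hZo : ∀ x ∉ U, Z x = ψ x)
    (hZφ : ∀ i' j', G.sLoc i' Z (φ i' j') = 0) :
    energy G.dom (ψ - ψms) (ψ - ψms) ≤ energy G.dom Z Z := by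
  obtain ⟨g, hg⟩ := hψ.1.2.exists_isH1
  obtain ⟨gm, hgm⟩ := hψms.1.2.exists_isH1
  have hO := (hφ.isOrth_iff i j ψ).1 hψ.2.1
  have hOm := (hφ.isOrth_iff i j ψms).1 hψms.2.1
  have hv := (hgm.sub hg).add hZ
  have hvV : G.MemV U (ψms - ψ + Z) :=
    ⟨fun x hx => by simp [hψms.1.1 x hx, hZo x hx], hv.memH1⟩
  have hvφ : ∀ i' j', G.sLoc i' (ψms - ψ + Z) (φ i' j') = 0 := fun i' j' => by
    rw [sLoc_add_left (memH1_elem_of_isH1 (hgm.sub hg) i') (memH1_elem_of_isH1 hZ i')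
      (hφ.memH1 i' j'), sLoc_sub_left (memH1_elem_of_isH1 hgm i') (memH1_elem_of_isH1 hg i')
      (hφ.memH1 i' j'), hZφ, add_zero]
    by_cases h : (⟨i', j'⟩ : (i : ι) × Fin (l i)) = ⟨i, j⟩
    · cases h
      rw [hO.1, hOm.1, sub_self]
    · rw [hO.2 i' j' h, hOm.2 i' j' h, sub_self]
  have o1 := hψ.energy_eq_zero hφ (hvV.mono hU) hvφ
  have o2 := hψms.energy_eq_zero hφ hvV hvφ
  have toDom : ∀ {u : Space d → ℝ} {gu : Space d → Space d}, IsH1 (Set.univ \ G.holes) u gu →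
      u ∈ h1Space G.dom := fun h => (h.mono G.isOpen_compl_holes G.dom_subset).memH1
  let p : h1Space G.dom := ⟨ψ, toDom hg⟩
  let q : h1Space G.dom := ⟨ψms, toDom hgm⟩
  let v : h1Space G.dom := ⟨ψms - ψ + Z, toDom hv⟩
  have o1' : energyForm G.isOpen_dom p v = 0 := o1
  have o2' : energyForm G.isOpen_dom q v = 0 := o2
  have o3' : energyForm G.isOpen_dom v p = 0 := energy_comm.trans o1
  have o4' : energyForm G.isOpen_dom v q = 0 := energy_comm.trans o2
  have e : energyForm G.isOpen_dom (p - q + v) (p - q + v) =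
      energyForm G.isOpen_dom (p - q) (p - q) + energyForm G.isOpen_dom v v := by
    simp only [map_add, LinearMap.add_apply, map_sub, LinearMap.sub_apply, o1', o2', o3', o4']
    ring
  have hZe : ((p - q + v : h1Space G.dom) : Space d → ℝ) = Z := by
    change ψ - ψms + (ψms - ψ + Z) = Z
    abel
  have e' : energy G.dom Z Z = energy G.dom (ψ - ψms) (ψ - ψms) +
      energy G.dom (ψms - ψ + Z) (ψms - ψ + Z) := by
    conv_lhs => rw [← hZe]
    exact e
  rw [e']
  exact le_add_of_nonneg_right energy_nonneg

/-- The lift of `φ_j^i` itself is an admissible competitor supported on one element. -/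
lemma IsMinimizer.energy_le (hd : d ≠ 0) (hφ : G.IsAuxBasis l φ) {i : ι} {j : Fin (l i)}
    {ψ : Space d → ℝ} (hψ : G.IsMinimizer φ i j G.dom ψ) :
    energy G.dom ψ ψ ≤ G.liftConst φ i * G.sLoc i (φ i j) (φ i j) := by
  classical
  obtain ⟨β, gβ, hβ, hβ0, hgβ0, hβs, hle⟩ := hφ.exists_lift hd i (hφ.fn i j)
  have hoff : ∀ k, k ≠ i → ∀ x ∈ G.elem k, x ∉ G.elem i := fun k hk x hx hx' =>
    Set.disjoint_left.1 (G.disjoint_elem hk) hx hx'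
  have h1 := hψ.2.2 β ⟨fun x hx => hβ0 x fun h => hx (G.elem_subset_dom i h), hβ.memH1⟩ ?_
  · refine h1.trans ?_
    rw [energy_dom_self hβ, Finset.sum_eq_single i (fun k _ hk => ?_) (by simp)]
    · exact hle
    · rw [setIntegral_congr_fun (g := fun _ => 0) (G.isOpen_elem k).measurableSet
        fun x hx => by simp [hgβ0 x (hoff k hk x hx)]]
      simp
  · rw [hφ.isOrth_iff]
    refine ⟨by rw [hβs]; exact (hφ.orthonormal i j j).trans (if_pos rfl), fun i' j' h => ?_⟩
    by_cases hi : i' = i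
    · subst hi
      rw [hβs]
      exact (hφ.orthonormal i' j j').trans (if_neg fun hj => h (by rw [hj]))
    · rw [sLoc_congr (u' := 0) (v' := φ i' j') (fun x hx => hβ0 x (hoff i' hi x hx)) fun x _ => rfl]
      simp [sLoc]

lemma outerEnergy_zero_le {i : ι} {ψ : Space d → ℝ} {g : Space d → Space d}
    (hg : IsH1 (Set.univ \ G.holes) ψ g) : G.outerEnergy g i 0 ≤ energy G.dom ψ ψ := by
  classical
  rw [energy_dom_self hg, outerEnergy]
  refine Finset.sum_le_sum fun k _ => ?_
  split_ifs
  · exact integral_nonneg fun x => sq_nonneg _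
  · exact le_rfl

lemma IsMinimizer.outerEnergy_mul_pow_le (hd : d ≠ 0) (hφ : G.IsAuxBasis l φ)
    (hgap : ∀ i, 0 < G.eigenvalue i (l i + 1)) {i : ι} {j : Fin (l i)} {ψ : Space d → ℝ}
    {g : Space d → Space d} (hψ : G.IsMinimizer φ i j G.dom ψ)
    (hg : IsH1 (Set.univ \ G.holes) ψ g) (K : ℕ) :
    G.outerEnergy g i K * (1 + √(G.Lam l (G.oversample i K)) /
      (2 * √(G.Dconst φ (G.oversample i K)))) ^ K ≤ energy G.dom ψ ψ := by
  have hi := hφ.elem_inter_oversample_nonempty (G.mem_layer_self i K)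
  have hN := hφ.maxVerts_le_Dconst hd hi
  have hD : 0 < G.Dconst φ (G.oversample i K) := by linarith
  have hΛ := Lam_pos hgap hi
  set θ := 1 + √(G.Lam l (G.oversample i K)) / (2 * √(G.Dconst φ (G.oversample i K))) with hθ
  have hθ0 : 0 ≤ θ := by positivity
  -- The rate is the one for `K` layers at every step; it is valid because the earlier layers are
  -- contained in these.
  have key : ∀ n ≤ K, G.outerEnergy g i n * θ ^ n ≤ energy G.dom ψ ψ := by
    intro n
    induction n with
    | zero => intro _; simpa using outerEnergy_zero_le hg
    | succ n ih =>
      intro hn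
      have hsub := G.layer_mono i hn
      have h1 := hψ.outerEnergy_succ_le hd hφ hg n hΛ hD hN.2
        (fun k hk => Lam_le (hφ.elem_inter_oversample_nonempty (hsub hk)))
        (fun k hk => liftConst_le (hφ.elem_inter_oversample_nonempty (hsub hk)))
      refine le_trans ?_ (ih (by omega))
      rw [pow_succ', ← mul_assoc]
      exact mul_le_mul_of_nonneg_right h1 (pow_nonneg hθ0 n)
  exact key K le_rfl

end PerforatedGrid

end CEM

end

theorem mainTheorem3 {d : ℕ} (hd : d = 2 ∨ d = 3) {ι ν : Type*} [Fintype ι] [Fintype ν]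
    (G : CEM.PerforatedGrid d ι ν)
    (l : ι → ℕ) (φ : (i : ι) → Fin (l i) → CEM.Space d → ℝ) (hφ : G.IsAuxBasis l φ)
    (hgap : ∀ i, 0 < G.eigenvalue i (l i + 1))
    (i : ι) (j : Fin (l i)) (k : ℕ) (hk : 2 ≤ k)
    (ψ ψms : CEM.Space d → ℝ)
    (hψ : G.IsMinimizer φ i j G.dom ψ)
    (hψms : G.IsMinimizer φ i j (G.oversample i k) ψms) :
    CEM.energy G.dom (ψ - ψms) (ψ - ψms) ≤ G.decay φ i k * G.sLoc i (φ i j) (φ i j) := by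
  have hd0 : d ≠ 0 := by omega
  obtain ⟨K, rfl⟩ : ∃ K, k = K + 1 := ⟨k - 1, by omega⟩
  obtain ⟨g, hg⟩ := hψ.1.2.exists_isH1
  obtain ⟨Z, gZ, hZ, hZo, hZφ, hin, hout, hring⟩ :=
    hφ.exists_test hd0 hψ.1.1 hψ.2.1 hg K
  have h1 := hψ.energy_sub_le hφ (G.oversample_subset_dom i (K + 1)) hψms hZ hZo hZφ
  have hi := hφ.elem_inter_oversample_nonempty (G.mem_layer_self i (K + 1))
  have hN := hφ.maxVerts_le_Dconst hd0 hi
  have hO := (hφ.isOrth_iff i j ψ).1 hψ.2.1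
  -- This includes the case where no element lies outside: then `Lam` is `0` and so is its inverse.
  have hc : 0 ≤ (G.Lam l (G.dom \ G.oversample i K))⁻¹ := by
    refine inv_nonneg.2 (Real.sInf_nonneg ?_)
    rintro _ ⟨i', -, rfl⟩
    exact (hgap i').le
  have h2 := CEM.PerforatedGrid.energy_test_le (φ := φ) hg hZ hin hout hring hc (by linarith) hN.2
    (fun k hk => by
      have hne := hφ.elem_inter_compl_nonempty hk
      have hpos := CEM.PerforatedGrid.Lam_pos hgap hne
      rw [inv_mul_eq_div, le_div_iff₀ hpos, mul_comm]
      refine (mul_le_mul_of_nonneg_right (CEM.PerforatedGrid.Lam_le (l := l) hne)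
        (G.sLoc_self_nonneg k ψ)).trans (hφ.poincare hg fun j' => hO.2 k j' fun h => hk ?_)
      have : k = i := congrArg Sigma.fst h
      rw [this]
      exact G.mem_layer_self i K)
    (fun k hk => CEM.PerforatedGrid.liftConst_le (hφ.elem_inter_oversample_nonempty hk))
  have h3 := hψ.outerEnergy_mul_pow_le hd0 hφ hgap hg K
  have h4 := (hψ.energy_le hd0 hφ).trans (mul_le_mul_of_nonneg_right
    (CEM.PerforatedGrid.liftConst_le hi) (G.sLoc_self_nonneg i (φ i j)))
  have hs := G.sLoc_self_nonneg i (φ i j)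
  unfold CEM.PerforatedGrid.decay
  rw [Nat.add_sub_cancel]
  set D := G.Dconst φ (G.oversample i (K + 1))
  set θ := 1 + √(G.Lam l (G.oversample i K)) / (2 * √(G.Dconst φ (G.oversample i K))) with hθ
  have hθ0 : 0 < θ := by positivity
  -- With `k = K + 1` the outermost layer is spent on the cutoff, which leaves `K` contraction
  -- steps.
  have e : θ ^ (1 - ((K + 1 : ℕ) : ℤ)) = (θ ^ K)⁻¹ := by
    rw [show (1 - ((K + 1 : ℕ) : ℤ)) = -(K : ℤ) by push_cast; ring, zpow_neg, zpow_natCast]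
  rw [e]
  have hpow : 0 < θ ^ K := pow_pos hθ0 K
  have h5 : G.outerEnergy g i K ≤ D * G.sLoc i (φ i j) (φ i j) * (θ ^ K)⁻¹ := by
    rw [← div_eq_mul_inv, le_div_iff₀ hpow]
    exact h3.trans h4
  have hD0 : 0 ≤ D := by linarith
  set c := (G.Lam l (G.dom \ G.oversample i K))⁻¹
  calc CEM.energy G.dom (ψ - ψms) (ψ - ψms) ≤ 6 * D * (1 + c) * G.outerEnergy g i K := h1.trans h2
    -- One `D` comes from the cutoff and the other from the starting energy; the constant `6` is
    -- relaxed to `8`.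
    _ ≤ 8 * D * (1 + c) * (D * G.sLoc i (φ i j) (φ i j) * (θ ^ K)⁻¹) := by
        refine mul_le_mul (by nlinarith) h5 ?_ (by positivity)
        refine Finset.sum_nonneg fun k _ => ?_
        split_ifs
        · exact le_rfl
        · exact MeasureTheory.integral_nonneg fun x => sq_nonneg _
    _ = 8 * D ^ 2 * (1 + c) * (θ ^ K)⁻¹ * G.sLoc i (φ i j) (φ i j) := by ring
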